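/- Let $\mathfrak g$ be a finite-dimensional simple real Lie algebra with a Lie algebra grading $\mathfrak g=\mathfrak g_{-1}\oplus\mathfrak g_0\oplus\mathfrak g_{+1}$, $\mathfrak g_{-1}\neq 0$ (so that $G_+=\exp\mathfrak g_{+1}$ is Abelian). Let $(t^a)_{a\in I}$ be a basis of homogeneous elements, $I_-$ the set of indices of grade $-1$ (denoted $\alpha$), and $J_a$ the coordinate functions on $\mathfrak g$ dual to $t^a$. Let $\eta^{ab}=\mathrm{tr}_R(t^at^b)$ be the trace form of a finite-dimensional representation $R$ for which it is non-degenerate, $\eta_{ab}$ its inverse, $t_a=\eta_{ab}t^b$, $[t_a,t_b]=f_{ab}^c\,t_c$, and equip the field $\mathbb R(J)$ of rational functions of the $J_a$ with the Lie–Poisson bracket, i.e. the biderivation with $\{J_a,J_b\}=f_{ab}^c J_c$. Put $J_{tot}=\sum_{a}J_a t^a$ and $\tilde t^-=\sum_{\alpha\in I_-}J_\alpha t^\alpha$, elements of $\mathbb R(J)\otimes\mathfrak g$. (a) There are $\tilde t^0\in\mathfrak g_0$ and $\tilde t^+\in\mathfrak g_{+1}$ with coefficients in $\mathbb R(J_\alpha)$,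 the field of rational functions of the $J_\alpha$ ($\alpha\in I_-$) only, such that $[\tilde t^0,\tilde t^\pm]=\pm\tilde t^\pm$ and $[\tilde t^+,\tilde t^-]=2\tilde t^0\neq 0$. (b) For every such $\mathfrak{sl}(2)$ there is a basis $(\tilde\ell^s)_{s\in I_{hw}}$ of the space of highest weight vectors $\{x:[\tilde t^+,x]=0\}$ with coefficients in $\mathbb R(J_\alpha)$. For every such basis there are a unique $c\in\mathbb R(J)\otimes\mathfrak g_{+1}$ and unique $\tilde W_s\in\mathbb R(J)$ such that, with $g=\exp c$, $$g^{-1}J_{tot}\,g=e^{-\mathrm{ad}\,c}J_{tot}=\tilde t^-+\sum_{s}\tilde W_s\,\tilde\ell^s .$$ (c) Each $\tilde W_s$ is a quotient of a polynomial in the $J_a$ by a nonzero polynomial in the $J_\alpha$ only. The set $\mathcal W$ of all rational functions $P(\tilde W_s,J_\alpha)/Q(J_\alpha)$, with $P,Q$ real polynomials and $Q\ne0$, is closed under the Poisson bracket, and it is exactly the set of quotients $P(J_a)/Q(J_\alpha)$ with $Q\neq0$ and $P$ a polynomial on $\mathfrak g$ invariant under conjugation by $G_+$ (the "enlarged" finite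 $W$-algebra). (d) The functions $J_\alpha$, $\alpha\in I_-$, lie in the center of $\mathcal W$: they belong to $\mathcal W$ and $\{J_\alpha,f\}=0$ for all $f\in\mathcal W$. -/

import Mathlib

open scoped TensorProduct

noncomputable section

namespace EnlargedW

/-- A Lie algebra grading `g = g₋₁ ⊕ g₀ ⊕ g₊₁` over `ℤ`; all other pieces vanish. -/
structure ThreeGrading (g : Type*) [LieRing g] [LieAlgebra ℝ g] where
  space : ℤ → Submodule ℝ g
  isInternal : DirectSum.IsInternal space
  lie_mem : ∀ i j : ℤ, ∀ x ∈ space i, ∀ y ∈ space j, ⁅x, y⁆ ∈ space (i + j)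
  eq_bot : ∀ i : ℤ, 1 < |i| → space i = ⊥

/-- Conjugation `X ↦ g⁻¹ X g` by `g = exp c`, that is `exp (-ad c)`, for `ad`-nilpotent `c`. -/
def conjExp (k : Type*) {L : Type*} [Field k] [Algebra ℚ k] [LieRing L] [LieAlgebra k L] (c : L) :
    L →ₗ[k] L :=
  letI : Module ℚ (L →ₗ[k] L) := Module.compHom _ (algebraMap ℚ k)
  IsNilpotent.exp (-(LieAlgebra.ad k L c) : Module.End k L)

section Functions

variable (ι : Type*)

/-- Rational functions over `ℝ` in the coordinates `J_a`, `a : ι`. -/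
abbrev RatFun := FractionRing (MvPolynomial ι ℝ)

variable {ι}

/-- A polynomial in the `J_a`, as a rational function. -/
def ofPoly (P : MvPolynomial ι ℝ) : RatFun ι := algebraMap (MvPolynomial ι ℝ) (RatFun ι) P

/-- The coordinate function `J_a`. -/
def coordJ (a : ι) : RatFun ι := ofPoly (MvPolynomial.X a)

/-- The partial derivative `∂f/∂J_a` of a rational function (quotient rule). -/
def partialJ (a : ι) (f : RatFun ι) : RatFun ι :=
  let p := IsFractionRing.num (MvPolynomial ι ℝ) f
  let q : MvPolynomial ι ℝ := IsFractionRing.den (MvPolynomial ι ℝ) f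
  ofPoly (MvPolynomial.pderiv a p * q - p * MvPolynomial.pderiv a q) / ofPoly (q ^ 2)

/-- The indices `α ∈ I₋`, of grade `-1`. -/
abbrev Neg (d : ι → ℤ) := {a : ι // d a = -1}

/-- A polynomial in the `J_α`, `α ∈ I₋`, as a rational function. -/
def ofNegPoly (d : ι → ℤ) (Q : MvPolynomial (Neg d) ℝ) : RatFun ι :=
  MvPolynomial.aeval (fun α : Neg d => coordJ α.1) Q

/-- Quotients `P(J_α)/Q(J_α)`: rational functions of the `J_α`, `α ∈ I₋`, only. -/
def negRational (d : ι → ℤ) : Set (RatFun ι) :=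
  {f | ∃ P Q : MvPolynomial (Neg d) ℝ, Q ≠ 0 ∧ f = ofNegPoly d P / ofNegPoly d Q}

/-- Quotients `P(J_a)/Q(J_α)`: polynomials in all `J_a` over polynomials in the `J_α` only. -/
def polyOverNeg (d : ι → ℤ) : Set (RatFun ι) :=
  {f | ∃ (P : MvPolynomial ι ℝ) (Q : MvPolynomial (Neg d) ℝ), Q ≠ 0 ∧
    f = ofPoly P / ofNegPoly d Q}

/-- The algebra of rational functions `P(W_s, J_α)/Q(J_α)` attached to a family `W`. -/
def wAlgebra (d : ι → ℤ) {S : Type*} (W : S → RatFun ι) : Set (RatFun ι) :=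
  {f | ∃ (P : MvPolynomial (S ⊕ Neg d) ℝ) (Q : MvPolynomial (Neg d) ℝ), Q ≠ 0 ∧
    f = MvPolynomial.aeval (Sum.elim W fun α => coordJ α.1) P / ofNegPoly d Q}

end Functions

section Poisson

variable {ι g : Type*} [Fintype ι] [DecidableEq ι] [LieRing g] [LieAlgebra ℝ g]
  (V : Type*) [AddCommGroup V] [Module ℝ V] [LieRingModule g V] [LieModule ℝ g V]
  (t : Module.Basis ι ℝ g)

/-- The metric `η^{ab} = ⟨t^a, t^b⟩ = tr_V (t^a t^b)`. -/
def metric : Matrix ι ι ℝ := Matrix.of fun a b => LieModule.traceForm ℝ g V (t a) (t b)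

/-- `t_a = η_{ab} t^b`, with `η_{ab}` the inverse of the metric. -/
def lowered (a : ι) : g := ∑ b, (metric V t)⁻¹ a b • t b

/-- `f_{ab}^c = ⟨[t_a, t_b], t^c⟩`, which is `η_{ad} η_{be} η^{cg} f^{de}_g`. -/
def structLow (a b c : ι) : ℝ := LieModule.traceForm ℝ g V ⁅lowered V t a, lowered V t b⁆ (t c)

/-- The Lie–Poisson bracket on rational functions, with `{J_a, J_b} = f_{ab}^c J_c`. -/
def poisson (f h : RatFun ι) : RatFun ι :=
  ∑ a, ∑ b, partialJ a f * partialJ b h *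
    ∑ c, algebraMap ℝ (RatFun ι) (structLow V t a b c) * coordJ c

end Poisson

section Generic

variable {ι g : Type*} [Fintype ι] [LieRing g] [LieAlgebra ℝ g]
  (t : Module.Basis ι ℝ g) (d : ι → ℤ)

/-- The full matrix `J_tot = J_a t^a`. -/
def jTot : RatFun ι ⊗[ℝ] g := ∑ a, coordJ a ⊗ₜ[ℝ] t a

/-- `t̃⁻ = J_α t^α`, the grade `-1` part of `J_tot`. -/
def tMinus : RatFun ι ⊗[ℝ] g := ∑ α : Neg d, coordJ α.1 ⊗ₜ[ℝ] t α.1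

/-- The coefficients of `x` on the `t^a` are rational functions of the `J_α` only. -/
def HasNegCoeffs (x : RatFun ι ⊗[ℝ] g) : Prop :=
  ∀ a, (t.baseChange (RatFun ι)).repr x a ∈ negRational d

/-- `{t̃⁻, t̃⁰, t̃⁺}` is an `sl(2)` containing `t̃⁻ = J_α t^α`, compatible with the grading, with
coefficients depending on the `J_α` only; `[t̃⁰, t̃^±] = ± t̃^±` and `[t̃⁺, t̃⁻] = 2 t̃⁰`. -/
structure IsNegSl2 (𝒢 : ThreeGrading g) (t0 tp : RatFun ι ⊗[ℝ] g) : Prop where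
  triple : IsSl2Triple ((2 : RatFun ι) • t0) tp (tMinus t d)
  zero_mem : t0 ∈ (𝒢.space 0).baseChange (RatFun ι)
  plus_mem : tp ∈ (𝒢.space 1).baseChange (RatFun ι)
  zero_coeffs : HasNegCoeffs t d t0
  plus_coeffs : HasNegCoeffs t d tp

/-- `ℓ` is a basis of the space of highest weight vectors `[t̃⁺, ℓ] = 0`, with coefficients
depending on the `J_α` only. -/
structure IsHwBasis {S : Type*} (tp : RatFun ι ⊗[ℝ] g) (ℓ : S → RatFun ι ⊗[ℝ] g) : Prop where
  linearIndependent : LinearIndependent (RatFun ι) ℓ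
  span_eq : Submodule.span (RatFun ι) (Set.range ℓ) =
    LinearMap.ker (LieAlgebra.ad (RatFun ι) (RatFun ι ⊗[ℝ] g) tp : Module.End (RatFun ι) (RatFun ι ⊗[ℝ] g))
  coeffs : ∀ s, HasNegCoeffs t d (ℓ s)

/-- `c` in `g₊₁` (over the rational functions) conjugates `J_tot` into the highest weight form
`J_α t^α + W_s ℓ^s`. -/
def IsHwForm {S : Type*} [Fintype S] (𝒢 : ThreeGrading g) (ℓ : S → RatFun ι ⊗[ℝ] g)
    (c : RatFun ι ⊗[ℝ] g) (W : S → RatFun ι) : Prop :=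
  c ∈ (𝒢.space 1).baseChange (RatFun ι) ∧
    conjExp (RatFun ι) c (jTot t) = tMinus t d + ∑ s, W s • ℓ s

/-- A polynomial function `P(J_a)` on `g` is invariant under conjugation by `G₊ = exp g₊₁`. -/
def IsInvariant (𝒢 : ThreeGrading g) (P : MvPolynomial ι ℝ) : Prop :=
  ∀ x ∈ 𝒢.space 1, ∀ X : g,
    MvPolynomial.eval (fun a => t.repr (conjExp ℝ x X) a) P =
      MvPolynomial.eval (fun a => t.repr X a) P

end Generic

end EnlargedW

end

open scoped TensorProduct

noncomputable section

/-!
The grading is the eigenspace decomposition of `ad h` for a grading element `h`. The partial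
derivatives of `f = t̃⁻` along the `J_α` run through all of `g₋₁`; differentiating
`⁅f, y⁆ = 0` along them shows that `ad f` is injective on `g₊₁`, and this completes `f` to an
`sl₂`-triple over `ℝ(J_α)`. Then `c ∈ g₊₁` solves a linear equation with coefficients in
`ℝ(J_α)`, whose right-hand side is linear in `J_tot`, so that the `W_s` are polynomial in the
`J_a` over `ℝ(J_α)`.

The Hamiltonian derivations of the linear functions `tr (u X)`, `u ∈ g₊₁`, generate the
conjugation by `G₊` and kill `ℝ(J_α)`. They kill the `W_s` because the highest weight form is
unique; conversely an invariant polynomial takes the same value at `J_tot` and at its highest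
weight form, hence is a polynomial in the `W_s` over `ℝ(J_α)`. So the algebra consists of the
functions which Poisson commute with these linear functions. The Jacobi identity makes it
closed under the bracket, and the `J_α` are central because they are themselves such linear
functions.
-/

namespace EnlargedW

section GradingElement

variable (k : Type*) {M : Type*} [Field k] [LieRing M] [LieAlgebra k M]

/-- The degree `i` elements for the grading of `M` by the integral eigenvalues of `ad h`. -/
def gradePiece (h : M) (i : ℤ) : Submodule k M := (LieAlgebra.ad k M h).eigenspace (i : k)

variable {k}

theorem mem_gradePiece {h : M} {i : ℤ} {x : M} : x ∈ gradePiece k h i ↔ ⁅h, x⁆ = (i : k) • x := by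
  rw [gradePiece, Module.End.mem_eigenspace_iff, LieAlgebra.ad_apply]

theorem lie_mem_gradePiece {h : M} {i j : ℤ} {x y : M} (hx : x ∈ gradePiece k h i)
    (hy : y ∈ gradePiece k h j) : ⁅x, y⁆ ∈ gradePiece k h (i + j) := by
  rw [mem_gradePiece] at *
  rw [leibniz_lie, hx, hy, smul_lie, lie_smul, ← add_smul, Int.cast_add]

theorem lie_comm_of_lie_eq_zero {a b : M} (hab : ⁅a, b⁆ = 0) (x : M) :
    ⁅a, ⁅b, x⁆⁆ = ⁅b, ⁅a, x⁆⁆ := by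
  rw [leibniz_lie, hab, zero_lie, zero_add]

/-- `h` is a grading element of a grading in degrees `-1, 0, 1`: the eigenvalues of `ad h` are
among `-1, 0, 1`, and `ad h` is diagonalizable. -/
def IsGradingElement (h : M) : Prop := ∀ x : M, ⁅h, ⁅h, ⁅h, x⁆⁆⁆ = ⁅h, x⁆

namespace IsGradingElement

variable [CharZero k] {h : M} {i : ℤ}

theorem eq_zero (hh : IsGradingElement h) (hi : 1 < |i|) {x : M} (hx : x ∈ gradePiece k h i) :
    x = 0 := by
  have h3 := hh x
  rw [mem_gradePiece] at hx
  simp only [hx, lie_smul, smul_smul] at h3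
  rw [← sub_eq_zero, ← sub_smul] at h3
  refine (smul_eq_zero.mp h3).resolve_left ?_
  norm_cast
  rw [← Ne, ← sub_one_mul, mul_ne_zero_iff, ← pow_two]
  exact ⟨(sub_pos.mpr (one_lt_sq_iff_one_lt_abs i |>.mpr hi)).ne',
    abs_pos.mp (zero_lt_one.trans hi)⟩

theorem exists_decomposition (hh : IsGradingElement h) (x : M) :
    ∃ u ∈ gradePiece k h (-1), ∃ v ∈ gradePiece k h 0, ∃ w ∈ gradePiece k h 1, x = u + v + w := by
  refine ⟨(2 : k)⁻¹ • (⁅h, ⁅h, x⁆⁆ - ⁅h, x⁆), ?_, x - ⁅h, ⁅h, x⁆⁆, ?_,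
    (2 : k)⁻¹ • (⁅h, ⁅h, x⁆⁆ + ⁅h, x⁆), ?_, by module⟩
  · rw [mem_gradePiece, lie_smul, lie_sub, hh]
    push_cast
    module
  · rw [mem_gradePiece, lie_sub, hh]
    simp
  · rw [mem_gradePiece, lie_smul, lie_add, hh]
    push_cast
    module

theorem lie_eq_zero (hh : IsGradingElement h) (hi : i ≠ 0) {x y : M} (hx : x ∈ gradePiece k h i)
    (hy : y ∈ gradePiece k h i) : ⁅x, y⁆ = 0 :=
  hh.eq_zero (lt_abs.mpr (by omega)) (lie_mem_gradePiece hx hy)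

theorem lie_lie_eq_zero (hh : IsGradingElement h) (hi : i ≠ 0) {a b x : M}
    (ha : a ∈ gradePiece k h i) (hb : b ∈ gradePiece k h i)
    (hx : x ∈ gradePiece k h 0 ⊔ gradePiece k h i) : ⁅a, ⁅b, x⁆⁆ = 0 := by
  obtain ⟨v, hv, w, hw, rfl⟩ := Submodule.mem_sup.mp hx
  have hv' : ⁅a, ⁅b, v⁆⁆ = 0 :=
    hh.eq_zero (lt_abs.mpr (by omega)) (lie_mem_gradePiece ha (lie_mem_gradePiece hb hv))
  rw [lie_add, lie_add, hv', hh.lie_eq_zero hi hb hw, lie_zero, add_zero]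

theorem lie_lie_lie_eq_zero (hh : IsGradingElement h) (hi : i ≠ 0) {a b c : M}
    (ha : a ∈ gradePiece k h i) (hb : b ∈ gradePiece k h i) (hc : c ∈ gradePiece k h i) (x : M) :
    ⁅a, ⁅b, ⁅c, x⁆⁆⁆ = 0 := by
  have hpiece : ∀ j : ℤ, |j| ≤ 1 → ∀ y ∈ gradePiece k h j, ⁅a, ⁅b, ⁅c, y⁆⁆⁆ = 0 := by
    intro j hj y hy
    have := abs_le.mp hj
    exact hh.eq_zero (lt_abs.mpr (by omega))
      (lie_mem_gradePiece ha (lie_mem_gradePiece hb (lie_mem_gradePiece hc hy)))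
  obtain ⟨u, hu, v, hv, w, hw, rfl⟩ := hh.exists_decomposition (k := k) x
  simp only [lie_add, hpiece (-1) (by simp) u hu, hpiece 0 (by simp) v hv,
    hpiece 1 (by simp) w hw, add_zero]

theorem isNilpotent_ad (hh : IsGradingElement h) (hi : i ≠ 0) {a : M}
    (ha : a ∈ gradePiece k h i) : IsNilpotent (LieAlgebra.ad k M a) :=
  ⟨3, LinearMap.ext fun x => by
    simpa [pow_succ] using hh.lie_lie_lie_eq_zero hi ha ha ha x⟩

theorem conjExp_apply [Algebra ℚ k] (hh : IsGradingElement h) {c : M}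
    (hc : c ∈ gradePiece k h 1) (x : M) :
    conjExp k c x = x - ⁅c, x⁆ + (2 : k)⁻¹ • ⁅c, ⁅c, x⁆⁆ := by
  let _ : Module ℚ (M →ₗ[k] M) := Module.compHom _ (algebraMap ℚ k)
  have hcube : (-(LieAlgebra.ad k M c) : Module.End k M) ^ 3 = 0 := by
    ext y
    simp [pow_succ, hh.lie_lie_lie_eq_zero one_ne_zero hc hc hc]
  have hsmul : ∀ (q : ℚ) (T : M →ₗ[k] M), q • T = (algebraMap ℚ k q) • T := fun _ _ => rfl
  rw [conjExp, IsNilpotent.exp_eq_sum hcube]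
  simp only [Finset.sum_range_succ, Finset.sum_range_zero, hsmul]
  simp [pow_succ, Nat.factorial, sub_eq_add_neg]

end IsGradingElement

end GradingElement

section JacobsonLemma

attribute [local instance] LieRing.ofAssociativeRing

variable {k R : Type*} [Field k] [Ring R] [Algebra k R] {A B : R}

theorem ad_pow_succ_mul (hAB : Commute A ⁅A, B⁆) (n : ℕ) (y : R) :
    (LieAlgebra.ad k R A ^ (n + 1)) (B * y) = B * (LieAlgebra.ad k R A ^ (n + 1)) y +
      (n + 1) • (⁅A, B⁆ * (LieAlgebra.ad k R A ^ n) y) := by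
  have hleibniz : ∀ x z : R, LieAlgebra.ad k R A (x * z) =
      x * LieAlgebra.ad k R A z + ⁅A, x⁆ * z := by
    intro x z
    simp only [LieAlgebra.ad_apply, Ring.lie_def]
    noncomm_ring
  induction n with
  | zero => simp [hleibniz]
  | succ n ih =>
    rw [pow_succ', Module.End.mul_apply, ih, map_add, map_nsmul, hleibniz, hleibniz,
      hAB.lie_eq, ← Module.End.mul_apply, ← Module.End.mul_apply, ← pow_succ', ← pow_succ',
      zero_mul, add_zero, add_assoc, succ_nsmul' _ (n + 1)]

theorem ad_pow_self_pow (hAB : Commute A ⁅A, B⁆) (n : ℕ) :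
    (LieAlgebra.ad k R A ^ n) (B ^ n) = n.factorial • ⁅A, B⁆ ^ n := by
  induction n with
  | zero => simp
  | succ n ih =>
    have hzero : (LieAlgebra.ad k R A ^ (n + 1)) (B ^ n) = 0 := by
      rw [pow_succ', Module.End.mul_apply, ih, map_nsmul, LieAlgebra.ad_apply,
        (hAB.pow_right n).lie_eq, smul_zero]
    rw [pow_succ' B, ad_pow_succ_mul hAB, hzero, ih, mul_zero, zero_add, mul_smul_comm, ← pow_succ',
      smul_smul, Nat.factorial_succ]

variable (k) [CharZero k]

include k in
theorem isNilpotent_lie_of_commute (hA : IsNilpotent A) (hAB : Commute A ⁅A, B⁆) :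
    IsNilpotent ⁅A, B⁆ := by
  obtain ⟨n, hn⟩ := LieAlgebra.ad_nilpotent_of_nilpotent (R := k) hA
  have hfact : (n.factorial : k) • ⁅A, B⁆ ^ n = 0 := by
    rw [Nat.cast_smul_eq_nsmul, ← ad_pow_self_pow (k := k) hAB, hn, LinearMap.zero_apply]
  exact ⟨n, (smul_eq_zero.mp hfact).resolve_left (Nat.cast_ne_zero.mpr n.factorial_ne_zero)⟩

end JacobsonLemma

section Killing

attribute [local instance] LieRing.ofAssociativeRing

variable {k M : Type*} [Field k] [CharZero k] [LieRing M] [LieAlgebra k M] {h : M} {i j : ℤ}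

theorem killingForm_eq_zero_of_mem_gradePiece (hij : i + j ≠ 0) {x y : M}
    (hx : x ∈ gradePiece k h i) (hy : y ∈ gradePiece k h j) : killingForm k M x y = 0 := by
  have hinv := LieModule.traceForm_apply_lie_apply' k M M h x y
  rw [mem_gradePiece.mp hx, mem_gradePiece.mp hy, map_smul, map_smul, LinearMap.smul_apply,
    smul_eq_mul, smul_eq_mul, ← sub_eq_zero, sub_neg_eq_add, ← add_mul] at hinv
  exact (mul_eq_zero.mp hinv).resolve_left (by exact_mod_cast hij)

variable (hh : IsGradingElement h)

include hh

/-- Up to the factor `i`, the value is `tr (ad h ∘ ad ⁅f, z⁆)`, and `ad ⁅f, z⁆ = ⁅ad f, ad z⁆` is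
nilpotent and commutes with `ad h`. -/
theorem killingForm_eq_zero_of_lie_lie_eq_zero (hi : i ≠ 0) {f z : M}
    (hf : f ∈ gradePiece k h i) (hz : z ∈ gradePiece k h (-i)) (hfz : ⁅f, ⁅f, z⁆⁆ = 0) :
    killingForm k M f z = 0 := by
  have hnil : IsNilpotent (LieAlgebra.ad k M ⁅f, z⁆) := by
    rw [LieHom.map_lie]
    refine isNilpotent_lie_of_commute k (hh.isNilpotent_ad hi hf) ?_
    rw [← LieHom.map_lie, commute_iff_lie_eq, ← LieHom.map_lie, hfz, map_zero]
  have hcomm : Commute (LieAlgebra.ad k M h) (LieAlgebra.ad k M ⁅f, z⁆) := by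
    have h0 := lie_mem_gradePiece hf hz
    rw [add_neg_cancel, mem_gradePiece, Int.cast_zero, zero_smul] at h0
    rw [commute_iff_lie_eq, ← LieHom.map_lie, h0, map_zero]
  have htrace : killingForm k M h ⁅f, z⁆ = 0 := by
    rw [killingForm_apply_apply]
    exact (LinearMap.isNilpotent_trace_of_isNilpotent (hcomm.isNilpotent_mul_left hnil)).eq_zero
  rw [← LieModule.traceForm_apply_lie_apply, mem_gradePiece.mp hf, map_smul, LinearMap.smul_apply,
    smul_eq_mul] at htrace
  exact (mul_eq_zero.mp htrace).resolve_left (by exact_mod_cast hi)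

variable (hK : (killingForm k M).Nondegenerate)

include hK

theorem eq_zero_of_forall_lie_lie_eq_zero {y : M} (hy : y ∈ gradePiece k h 1)
    (hyx : ∀ x ∈ gradePiece k h (-1), ⁅y, ⁅y, x⁆⁆ = 0) : y = 0 := by
  refine hK.1 y fun z => ?_
  obtain ⟨u, hu, v, hv, w, hw, rfl⟩ := hh.exists_decomposition (k := k) z
  rw [map_add, map_add, killingForm_eq_zero_of_lie_lie_eq_zero hh one_ne_zero hy hu (hyx u hu),
    killingForm_eq_zero_of_mem_gradePiece (by norm_num) hy hv,
    killingForm_eq_zero_of_mem_gradePiece (by norm_num) hy hw, add_zero, add_zero]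

/-- `f` is orthogonal to `ker (ad f)²`, which is the orthogonal of the range of `(ad f)²`. -/
theorem exists_lie_lie_eq_self [FiniteDimensional k M] {f : M} (hf : f ∈ gradePiece k h (-1)) :
    ∃ e ∈ gradePiece k h 1, ⁅f, ⁅f, e⁆⁆ = f := by
  have hdec : ∀ z : M, ∃ w ∈ gradePiece k h 1,
      ⁅f, ⁅f, z⁆⁆ = ⁅f, ⁅f, w⁆⁆ ∧ killingForm k M f z = killingForm k M f w := by
    intro z
    obtain ⟨u, hu, v, hv, w, hw, rfl⟩ := hh.exists_decomposition (k := k) z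
    refine ⟨w, hw, ?_, ?_⟩
    · have huv : u + v ∈ gradePiece k h 0 ⊔ gradePiece k h (-1) := by
        rw [add_comm]
        exact Submodule.add_mem_sup hv hu
      rw [lie_add, lie_add, hh.lie_lie_eq_zero (by norm_num) hf hf huv, zero_add]
    · rw [map_add, map_add, killingForm_eq_zero_of_mem_gradePiece (by norm_num) hf hu,
        killingForm_eq_zero_of_mem_gradePiece (by norm_num) hf hv, zero_add, zero_add]
  let T : M →ₗ[k] M := LieAlgebra.ad k M f * LieAlgebra.ad k M f
  have hortho : (killingForm k M).orthogonal (LinearMap.range T) ≤ LinearMap.ker T := by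
    intro z hz
    refine LinearMap.mem_ker.mpr (hK.1 _ fun x => ?_)
    have hzx : killingForm k M ⁅f, ⁅f, x⁆⁆ z = 0 := hz (T x) ⟨x, rfl⟩
    rwa [LieModule.traceForm_apply_lie_apply', LieModule.traceForm_apply_lie_apply', neg_neg,
      LieModule.traceForm_comm] at hzx
  have hmem : f ∈ LinearMap.range T := by
    rw [← LinearMap.BilinForm.orthogonal_orthogonal hK (LieModule.traceForm_isSymm k M M).isRefl
      (LinearMap.range T)]
    intro z hz
    obtain ⟨w, hw, hTw, hκ⟩ := hdec z
    have hTz : ⁅f, ⁅f, z⁆⁆ = 0 := hortho hz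
    refine (LieModule.traceForm_comm k M M z f).trans (hκ.trans ?_)
    exact killingForm_eq_zero_of_lie_lie_eq_zero hh (by norm_num) hf (by simpa using hw)
      (hTw ▸ hTz)
  obtain ⟨x, hx⟩ := hmem
  obtain ⟨w, hw, hTw, -⟩ := hdec x
  exact ⟨w, hw, hTw ▸ hx⟩

end Killing

section Slice

variable (k : Type*) {M : Type*} [Field k] [LieRing M] [LieAlgebra k M]

/-- An `sl₂`-triple `{f, T, e}` with `f` of degree `-1` and `e` of degree `1` for the grading of `M`
by `h`, where `ad f` is injective in degree `1`. Then `f + ker (ad e)` is a slice for the action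
of `exp M₁` on `f + M₀ + M₁`. -/
structure IsSliceTriple (h T e f : M) : Prop where
  isGradingElement : IsGradingElement h
  triple : IsSl2Triple T e f
  e_mem : e ∈ gradePiece k h 1
  f_mem : f ∈ gradePiece k h (-1)
  eq_zero_of_lie_eq_zero : ∀ y ∈ gradePiece k h 1, ⁅f, y⁆ = 0 → y = 0

variable {k} [CharZero k] {h T e f : M}

theorem isSl2Triple_of_lie_lie (hf : f ∈ gradePiece k h (-1)) (hf0 : f ≠ 0)
    (he : e ∈ gradePiece k h 1) (hfe : ⁅f, ⁅f, e⁆⁆ = (-2 : k) • f)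
    (hinj : ∀ y ∈ gradePiece k h 1, ⁅f, y⁆ = 0 → y = 0) : IsSl2Triple ⁅e, f⁆ e f := by
  have hef : ⁅e, f⁆ ∈ gradePiece k h 0 := by simpa using lie_mem_gradePiece he hf
  have hTf : ⁅⁅e, f⁆, f⁆ = (-2 : k) • f := by
    rw [← hfe, ← lie_skew ⁅e, f⁆ f, ← lie_skew f e, lie_neg]
  have hTe : ⁅⁅e, f⁆, e⁆ = (2 : k) • e := by
    rw [← sub_eq_zero]
    refine hinj _ (sub_mem (by simpa using lie_mem_gradePiece hef he)
      (Submodule.smul_mem _ _ he)) ?_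
    rw [lie_sub, leibniz_lie, ← lie_skew f ⁅e, f⁆, hTf, lie_smul, ← lie_skew f e, lie_neg, lie_self]
    simp only [neg_lie, smul_lie, ← lie_skew f e]
    module
  refine ⟨fun h0 => ?_, rfl, ?_, ?_⟩
  · rw [h0, zero_lie] at hTf
    exact hf0 ((smul_eq_zero.mp hTf.symm).resolve_left (by norm_num))
  · rw [hTe, ← Nat.cast_smul_eq_nsmul k, Nat.cast_ofNat]
  · rw [hTf, ← Nat.cast_smul_eq_nsmul k, Nat.cast_ofNat, neg_smul]

namespace IsSliceTriple

/-- As `e` and `c` commute, `ad e` maps `(ad f)² c` to `-2 ⁅f, c⁆` and `(ad f)³ c = 0` to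
`-6 (ad f)² c`. -/
theorem eq_zero_of_lie_lie_eq_zero (hs : IsSliceTriple k h T e f) {c : M}
    (hc : c ∈ gradePiece k h 1) (hecf : ⁅e, ⁅c, f⁆⁆ = 0) : c = 0 := by
  have hTf : ⁅T, f⁆ = (-2 : k) • f := by
    rw [hs.triple.lie_h_f_nsmul, ← Nat.cast_smul_eq_nsmul k, Nat.cast_ofNat, neg_smul]
  have hefc : ⁅e, ⁅f, c⁆⁆ = 0 := by rw [← lie_skew f c, lie_neg, hecf, neg_zero]
  have hTc : ⁅T, c⁆ = 0 := by
    rw [← hs.triple.lie_e_f, lie_lie, hs.isGradingElement.lie_eq_zero one_ne_zero hs.e_mem hc,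
      lie_zero, sub_zero, hefc]
  have hTfc : ⁅T, ⁅f, c⁆⁆ = (-2 : k) • ⁅f, c⁆ := by
    rw [leibniz_lie, hTf, hTc, lie_zero, add_zero, smul_lie]
  have hTffc : ⁅T, ⁅f, ⁅f, c⁆⁆⁆ = (-4 : k) • ⁅f, ⁅f, c⁆⁆ := by
    rw [leibniz_lie, hTf, hTfc, lie_smul, smul_lie]
    module
  have heffc : ⁅e, ⁅f, ⁅f, c⁆⁆⁆ = (-2 : k) • ⁅f, c⁆ := by
    rw [leibniz_lie, hs.triple.lie_e_f, hTfc, hefc, lie_zero, add_zero]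
  have hefffc : ⁅e, ⁅f, ⁅f, ⁅f, c⁆⁆⁆⁆ = (-6 : k) • ⁅f, ⁅f, c⁆⁆ := by
    rw [leibniz_lie, hs.triple.lie_e_f, hTffc, heffc, lie_smul]
    module
  have hffc : ⁅f, ⁅f, c⁆⁆ = 0 := by
    rw [hs.isGradingElement.lie_lie_lie_eq_zero (by norm_num) hs.f_mem hs.f_mem hs.f_mem,
      lie_zero] at hefffc
    exact (smul_eq_zero.mp hefffc.symm).resolve_left (by norm_num)
  rw [hffc, lie_zero] at heffc
  exact hs.eq_zero_of_lie_eq_zero c hc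
    ((smul_eq_zero.mp heffc.symm).resolve_left (by norm_num))

theorem eq_of_lie_lie_eq (hs : IsSliceTriple k h T e f) {c c' : M} (hc : c ∈ gradePiece k h 1)
    (hc' : c' ∈ gradePiece k h 1) (hcc : ⁅e, ⁅c, f⁆⁆ = ⁅e, ⁅c', f⁆⁆) : c = c' :=
  sub_eq_zero.mp <| hs.eq_zero_of_lie_lie_eq_zero (sub_mem hc hc') <| by
    rw [sub_lie, lie_sub, hcc, sub_self]

theorem exists_lie_lie_eq [FiniteDimensional k M] (hs : IsSliceTriple k h T e f) {w : M}
    (hw : w ∈ gradePiece k h 1) : ∃ c ∈ gradePiece k h 1, ⁅e, ⁅c, f⁆⁆ = w := by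
  let S : M →ₗ[k] M := -(LieAlgebra.ad k M e * LieAlgebra.ad k M f)
  have hS : ∀ c, S c = ⁅e, ⁅c, f⁆⁆ := by
    intro c
    rw [← lie_skew c f, lie_neg]
    rfl
  have hmaps : ∀ c ∈ gradePiece k h 1, S c ∈ gradePiece k h 1 := by
    intro c hc
    rw [hS]
    simpa using lie_mem_gradePiece hs.e_mem (lie_mem_gradePiece hc hs.f_mem)
  have hinj : Function.Injective (S.restrict hmaps) := by
    rw [← LinearMap.ker_eq_bot, LinearMap.ker_eq_bot']
    intro c hc
    refine Subtype.ext (hs.eq_zero_of_lie_lie_eq_zero c.2 ?_)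
    rw [← hS]
    exact congrArg Subtype.val hc
  obtain ⟨c, hc⟩ := LinearMap.injective_iff_surjective.mp hinj ⟨w, hw⟩
  exact ⟨c, c.2, by rw [← hS]; exact congrArg Subtype.val hc⟩

theorem lie_conjExp_sub [Algebra ℚ k] (hs : IsSliceTriple k h T e f) {c x : M}
    (hc : c ∈ gradePiece k h 1) (hx : x - f ∈ gradePiece k h 0 ⊔ gradePiece k h 1) :
    ⁅e, conjExp k c x - f⁆ = ⁅e, x - f⁆ - ⁅e, ⁅c, f⁆⁆ := by
  have hh := hs.isGradingElement
  have hcube : ⁅e, ⁅c, ⁅c, x⁆⁆⁆ = 0 := hh.lie_lie_lie_eq_zero one_ne_zero hs.e_mem hc hc x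
  have hsq : ⁅e, ⁅c, x⁆⁆ = ⁅e, ⁅c, f⁆⁆ := by
    rw [← sub_eq_zero, ← lie_sub, ← lie_sub]
    exact hh.lie_lie_eq_zero one_ne_zero hs.e_mem hc hx
  rw [hh.conjExp_apply hc]
  simp only [lie_add, lie_sub, lie_smul, hcube, hsq, smul_zero]
  abel

theorem lie_sub_mem (hs : IsSliceTriple k h T e f) {x : M}
    (hx : x - f ∈ gradePiece k h 0 ⊔ gradePiece k h 1) : ⁅e, x - f⁆ ∈ gradePiece k h 1 := by
  obtain ⟨v, hv, w, hw, hvw⟩ := Submodule.mem_sup.mp hx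
  rw [← hvw, lie_add, hs.isGradingElement.lie_eq_zero one_ne_zero hs.e_mem hw, add_zero]
  simpa using lie_mem_gradePiece hs.e_mem hv

variable {S : Type*} [Fintype S] {ℓ : S → M}

theorem lie_lie_eq_of_conjExp_eq [Algebra ℚ k] (hs : IsSliceTriple k h T e f)
    (hℓ : ∀ s, ⁅e, ℓ s⁆ = 0) {c x : M} (hc : c ∈ gradePiece k h 1)
    (hx : x - f ∈ gradePiece k h 0 ⊔ gradePiece k h 1) {W : S → k}
    (hW : conjExp k c x = f + ∑ s, W s • ℓ s) : ⁅e, ⁅c, f⁆⁆ = ⁅e, x - f⁆ := by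
  have hzero : ⁅e, conjExp k c x - f⁆ = 0 := by
    simp only [hW, add_sub_cancel_left, lie_sum, lie_smul, hℓ, smul_zero, Finset.sum_const_zero]
  rw [hs.lie_conjExp_sub hc hx] at hzero
  exact (sub_eq_zero.mp hzero).symm

theorem existsUnique_conjExp_eq [Algebra ℚ k] [FiniteDimensional k M]
    (hs : IsSliceTriple k h T e f) (hli : LinearIndependent k ℓ)
    (hspan : Submodule.span k (Set.range ℓ) = LinearMap.ker (LieAlgebra.ad k M e)) {x : M}
    (hx : x - f ∈ gradePiece k h 0 ⊔ gradePiece k h 1) :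
    ∃! cW : M × (S → k), cW.1 ∈ gradePiece k h 1 ∧
      conjExp k cW.1 x = f + ∑ s, cW.2 s • ℓ s := by
  have hℓ : ∀ s, ⁅e, ℓ s⁆ = 0 := fun s =>
    hspan.le (Submodule.subset_span (Set.mem_range_self s))
  obtain ⟨c, hc, hcf⟩ := hs.exists_lie_lie_eq (hs.lie_sub_mem hx)
  have hker : conjExp k c x - f ∈ Submodule.span k (Set.range ℓ) := by
    rw [hspan, LinearMap.mem_ker, LieAlgebra.ad_apply, hs.lie_conjExp_sub hc hx, hcf, sub_self]
  obtain ⟨W, hW⟩ := (Submodule.mem_span_range_iff_exists_fun k).mp hker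
  refine ⟨(c, W), ⟨hc, by rw [hW, add_sub_cancel]⟩, ?_⟩
  rintro ⟨c', W'⟩ ⟨hc', hW'⟩
  obtain rfl : c' = c :=
    hs.eq_of_lie_lie_eq hc' hc ((hs.lie_lie_eq_of_conjExp_eq hℓ hc' hx hW').trans hcf.symm)
  have hWW : ∑ s, W' s • ℓ s = ∑ s, W s • ℓ s := by
    rw [hW, ← add_sub_cancel_left f (∑ s, W' s • ℓ s), ← hW']
  rw [Prod.mk.injEq]
  exact ⟨rfl, hli.fintypeLinearCombination_injective hWW⟩

end IsSliceTriple

end Slice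

section GradedBasis

variable {F M ι : Type*} [Field F] [LieRing M] [LieAlgebra F M]

/-- A basis of homogeneous elements for the grading of `M` by `ad h`; the element `t a` has
degree `d a`, which is `-1`, `0` or `1`. -/
structure IsGradedBasis (t : Module.Basis ι F M) (d : ι → ℤ) (h : M) : Prop where
  lie_basis : ∀ a, ⁅h, t a⁆ = (d a : F) • t a
  abs_le_one : ∀ a, |d a| ≤ 1

namespace IsGradedBasis

variable {t : Module.Basis ι F M} {d : ι → ℤ} {h : M}

theorem basis_mem_gradePiece (ht : IsGradedBasis t d h) (a : ι) : t a ∈ gradePiece F h (d a) :=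
  mem_gradePiece.mpr (ht.lie_basis a)

theorem repr_lie (ht : IsGradedBasis t d h) (x : M) (a : ι) :
    t.repr ⁅h, x⁆ a = d a * t.repr x a := by
  classical
  have hcoord : t.coord a ∘ₗ LieAlgebra.ad F M h = (d a : F) • t.coord a := by
    refine t.ext fun b => ?_
    by_cases hab : b = a
    · simp [ht.lie_basis, hab]
    · simp [ht.lie_basis, hab]
  exact LinearMap.congr_fun hcoord x

theorem isGradingElement (ht : IsGradedBasis t d h) : IsGradingElement h := by
  refine fun x => t.repr.injective (Finsupp.ext fun a => ?_)
  have hd : (d a : F) * (d a * d a) = d a := by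
    have := abs_le.mp (ht.abs_le_one a)
    obtain ha | ha | ha : d a = -1 ∨ d a = 0 ∨ d a = 1 := by omega
    all_goals simp [ha]
  rw [ht.repr_lie, ht.repr_lie, ht.repr_lie, ← mul_assoc, ← mul_assoc, mul_assoc (d a : F), hd]

theorem baseChange (k : Type*) [Field k] [Algebra F k] (ht : IsGradedBasis t d h) :
    IsGradedBasis (t.baseChange k) d ((1 : k) ⊗ₜ[F] h) where
  lie_basis a := by
    rw [Module.Basis.baseChange_apply, LieAlgebra.ExtendScalars.bracket_tmul, ht.lie_basis,
      TensorProduct.tmul_smul, TensorProduct.smul_tmul', TensorProduct.smul_tmul', one_mul,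
      Algebra.smul_def, map_intCast, smul_eq_mul]
  abs_le_one := ht.abs_le_one

variable [CharZero F]

theorem mem_gradePiece_iff (ht : IsGradedBasis t d h) {i : ℤ} {x : M} :
    x ∈ gradePiece F h i ↔ ∀ a, d a ≠ i → t.repr x a = 0 := by
  rw [mem_gradePiece, ← t.repr.injective.eq_iff, DFunLike.ext_iff]
  refine forall_congr' fun a => ?_
  rw [ht.repr_lie, map_smul, Finsupp.smul_apply, smul_eq_mul, ← sub_eq_zero, ← sub_mul,
    mul_eq_zero, sub_eq_zero, Int.cast_inj, ← or_iff_not_imp_left]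

theorem gradePiece_eq_span (ht : IsGradedBasis t d h) (i : ℤ) :
    gradePiece F h i = Submodule.span F (t '' {a | d a = i}) := by
  ext x
  rw [t.mem_span_image, ht.mem_gradePiece_iff]
  simp only [Set.subset_def, Finset.mem_coe, Finsupp.mem_support_iff, Set.mem_ofPred_eq]
  exact forall_congr' fun a => not_imp_comm

theorem exists_eq_of_gradePiece_ne_bot (ht : IsGradedBasis t d h) {i : ℤ}
    (hi : gradePiece F h i ≠ ⊥) : ∃ a, d a = i := by
  contrapose! hi
  simp [ht.gradePiece_eq_span, hi]

theorem baseChange_gradePiece (k : Type*) [Field k] [Algebra F k]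
    (ht : IsGradedBasis t d h) (i : ℤ) :
    (gradePiece F h i).baseChange k = gradePiece k ((1 : k) ⊗ₜ[F] h) i := by
  have : CharZero k := charZero_of_injective_algebraMap (algebraMap F k).injective
  rw [ht.gradePiece_eq_span, (ht.baseChange k).gradePiece_eq_span, Submodule.baseChange_span]
  congr 1
  ext x
  simp

end IsGradedBasis

end GradedBasis

namespace ThreeGrading

variable {g : Type*} [LieRing g] [LieAlgebra ℝ g] (𝒢 : ThreeGrading g)

/-- The linear operator which multiplies by `i` in degree `i`. -/
def degreeMap : g →ₗ[ℝ] g :=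
  DirectSum.toModule ℝ ℤ g (fun i => (i : ℝ) • (𝒢.space i).subtype) ∘ₗ
    (LinearEquiv.ofBijective (DirectSum.coeLinearMap 𝒢.space) 𝒢.isInternal).symm.toLinearMap

theorem degreeMap_apply {i : ℤ} {x : g} (hx : x ∈ 𝒢.space i) :
    𝒢.degreeMap x = (i : ℝ) • x := by
  have hpre : (LinearEquiv.ofBijective (DirectSum.coeLinearMap 𝒢.space) 𝒢.isInternal).symm x =
      DirectSum.lof ℝ ℤ (fun i => 𝒢.space i) i ⟨x, hx⟩ :=
    (LinearEquiv.symm_apply_eq _).mpr (DirectSum.coeLinearMap_lof 𝒢.space i ⟨x, hx⟩).symm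
  rw [degreeMap, LinearMap.comp_apply, LinearEquiv.coe_coe, hpre, DirectSum.toModule_lof,
    LinearMap.smul_apply, Submodule.subtype_apply]

theorem degreeMap_lie (x y : g) :
    𝒢.degreeMap ⁅x, y⁆ = ⁅x, 𝒢.degreeMap y⁆ - ⁅y, 𝒢.degreeMap x⁆ := by
  have htop : ∀ z : g, z ∈ ⨆ i, 𝒢.space i := fun z => by
    rw [𝒢.isInternal.submodule_iSup_eq_top]
    exact Submodule.mem_top
  induction htop x using Submodule.iSup_induction' with
  | zero => simp
  | add x x' _ _ hx hx' => rw [add_lie, map_add, map_add, lie_add, add_lie, hx, hx']; abel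
  | mem i x hx =>
    induction htop y using Submodule.iSup_induction' with
    | zero => simp
    | add y y' _ _ hy hy' => rw [lie_add, map_add, map_add, lie_add, add_lie, hy, hy']; abel
    | mem j y hy =>
      rw [𝒢.degreeMap_apply hx, 𝒢.degreeMap_apply hy,
        𝒢.degreeMap_apply (𝒢.lie_mem i j x hx y hy), lie_smul, lie_smul, ← lie_skew x y]
      push_cast
      module

theorem exists_lie_eq_smul [FiniteDimensional ℝ g] [LieAlgebra.IsKilling ℝ g] :
    ∃ h : g, ∀ i, ∀ x ∈ 𝒢.space i, ⁅h, x⁆ = (i : ℝ) • x := by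
  obtain ⟨h, hh⟩ := LieDerivation.IsKilling.exists_eq_ad
    (⟨𝒢.degreeMap, 𝒢.degreeMap_lie⟩ : LieDerivation ℝ g g)
  refine ⟨h, fun i x hx => ?_⟩
  rw [← 𝒢.degreeMap_apply hx, ← LieDerivation.ad_apply_apply ℝ, hh]
  rfl

variable {𝒢} {ι : Type*} {t : Module.Basis ι ℝ g} {d : ι → ℤ} {h : g}

theorem isGradedBasis (hh : ∀ i, ∀ x ∈ 𝒢.space i, ⁅h, x⁆ = (i : ℝ) • x)
    (ht : ∀ a, t a ∈ 𝒢.space (d a)) : IsGradedBasis t d h where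
  lie_basis a := hh _ _ (ht a)
  abs_le_one a := not_lt.mp fun hd => t.ne_zero a (by simpa [𝒢.eq_bot _ hd] using ht a)

theorem space_eq_gradePiece (hh : ∀ i, ∀ x ∈ 𝒢.space i, ⁅h, x⁆ = (i : ℝ) • x)
    (ht : ∀ a, t a ∈ 𝒢.space (d a)) (i : ℤ) : 𝒢.space i = gradePiece ℝ h i := by
  refine le_antisymm (fun x hx => mem_gradePiece.mpr (hh i x hx)) ?_
  rw [(isGradedBasis hh ht).gradePiece_eq_span, Submodule.span_le]
  rintro _ ⟨a, rfl, rfl⟩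
  exact ht a

end ThreeGrading

section KillingBaseChange

variable {F : Type*} [Field F] (k : Type*) [Field k] [Algebra F k]

theorem nondegenerate_baseChange {E : Type*} [AddCommGroup E] [Module F E] [FiniteDimensional F E]
    {B : LinearMap.BilinForm F E} (hB : B.Nondegenerate) : (B.baseChange k).Nondegenerate := by
  let b := Module.finBasis F E
  have hmatrix : LinearMap.BilinForm.toMatrix (b.baseChange k) (B.baseChange k) =
      (LinearMap.BilinForm.toMatrix b B).map (algebraMap F k) := by
    ext i j
    simp [LinearMap.BilinForm.toMatrix_apply, Algebra.smul_def]
  rw [LinearMap.BilinForm.nondegenerate_iff_det_ne_zero (b.baseChange k), hmatrix,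
    ← RingHom.mapMatrix_apply, ← RingHom.map_det, Ne,
    FaithfulSMul.algebraMap_eq_zero_iff]
  exact (LinearMap.BilinForm.nondegenerate_iff_det_ne_zero b).mp hB

theorem killingForm_baseChange_nondegenerate {g : Type*} [LieRing g] [LieAlgebra F g]
    [FiniteDimensional F g] [LieAlgebra.IsKilling F g] :
    (killingForm k (k ⊗[F] g)).Nondegenerate := by
  rw [killingForm, LieModule.traceForm_baseChange]
  exact nondegenerate_baseChange k (LieAlgebra.IsKilling.killingForm_nondegenerate F g)

end KillingBaseChange

section Coefficients

variable {F k : Type*} [Field F] [Field k] [Algebra F k]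

section MapCoeff

variable {g : Type*} [LieRing g] [LieAlgebra F g] {ι : Type*} (t : Module.Basis ι F g)

/-- An endomorphism of the scalars, applied to the coefficients of the elements of `k ⊗ g`. -/
def mapCoeff (φ : k →ₗ[F] k) : k ⊗[F] g →ₗ[F] k ⊗[F] g := φ.rTensor g

theorem repr_mapCoeff (φ : k →ₗ[F] k) (x : k ⊗[F] g) (a : ι) :
    (t.baseChange k).repr (mapCoeff φ x) a = φ ((t.baseChange k).repr x a) := by
  induction x with
  | zero => simp
  | tmul c y => simp [mapCoeff]
  | add x y hx hy => simp [hx, hy]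

theorem mapCoeff_one_tmul_lie (φ : k →ₗ[F] k) (u : g) (x : k ⊗[F] g) :
    mapCoeff φ ⁅(1 : k) ⊗ₜ[F] u, x⁆ = ⁅(1 : k) ⊗ₜ[F] u, mapCoeff φ x⁆ := by
  induction x with
  | zero => simp
  | tmul c y => simp [mapCoeff, LieAlgebra.ExtendScalars.bracket_tmul]
  | add x y hx hy => simp only [lie_add, map_add, hx, hy]

theorem mapCoeff_mem_gradePiece (φ : k →ₗ[F] k) {h : g} {i : ℤ} {x : k ⊗[F] g}
    (hx : x ∈ gradePiece k ((1 : k) ⊗ₜ[F] h) i) :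
    mapCoeff φ x ∈ gradePiece k ((1 : k) ⊗ₜ[F] h) i := by
  rw [mem_gradePiece, Int.cast_smul_eq_zsmul] at hx ⊢
  rw [← mapCoeff_one_tmul_lie, hx, map_zsmul]

theorem mapCoeff_derivation_smul (D : Derivation F k k) (c : k) (x : k ⊗[F] g) :
    mapCoeff (D : k →ₗ[F] k) (c • x) = D c • x + c • mapCoeff (D : k →ₗ[F] k) x := by
  induction x with
  | zero => simp
  | add x y hx hy => simp only [smul_add, map_add, hx, hy]; abel
  | tmul c' u =>
    simp [mapCoeff, TensorProduct.smul_tmul', TensorProduct.add_tmul, mul_comm, add_comm]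

theorem mapCoeff_derivation_lie (D : Derivation F k k) (x y : k ⊗[F] g) :
    mapCoeff (D : k →ₗ[F] k) ⁅x, y⁆ =
      ⁅mapCoeff (D : k →ₗ[F] k) x, y⁆ + ⁅x, mapCoeff (D : k →ₗ[F] k) y⁆ := by
  induction x with
  | zero => simp
  | add x x' hx hx' => simp only [add_lie, map_add, hx, hx']; abel
  | tmul c u =>
    induction y with
    | zero => simp
    | add y y' hy hy' => simp only [lie_add, map_add, hy, hy']; abel
    | tmul c' v =>
      simp [mapCoeff, LieAlgebra.ExtendScalars.bracket_tmul, TensorProduct.add_tmul, mul_comm,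
        add_comm]

end MapCoeff

section Coeffs

variable {g : Type*} [LieRing g] [LieAlgebra F g] {ι : Type*} [Fintype ι]
  (t : Module.Basis ι F g)

theorem repr_baseChange_lie (x y : k ⊗[F] g) (a : ι) :
    (t.baseChange k).repr ⁅x, y⁆ a = ∑ b, ∑ c, t.repr ⁅t b, t c⁆ a •
      ((t.baseChange k).repr x b * (t.baseChange k).repr y c) := by
  conv_lhs => rw [← (t.baseChange k).sum_repr x, ← (t.baseChange k).sum_repr y, sum_lie]
  simp only [lie_sum, smul_lie, lie_smul, Module.Basis.baseChange_apply,
    LieAlgebra.ExtendScalars.bracket_tmul, map_sum, map_smul, Finsupp.finsetSum_apply,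
    Finsupp.smul_apply, Module.Basis.baseChange_repr_tmul, smul_eq_mul, mul_smul_comm, mul_one]
  exact Finset.sum_congr rfl fun b _ => Finset.sum_congr rfl fun c _ =>
    congrArg _ (mul_comm _ _)

/-- The elements of `k ⊗ g` whose coefficients on the basis `t` lie in `A`. -/
def coeffs (A : Subalgebra F k) : LieSubalgebra F (k ⊗[F] g) where
  carrier := {x | ∀ a, (t.baseChange k).repr x a ∈ A}
  add_mem' hx hy a := by
    rw [map_add]
    exact add_mem (hx a) (hy a)
  zero_mem' a := by
    rw [map_zero]
    exact zero_mem A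
  smul_mem' r x hx a := by
    rw [← algebraMap_smul k r x, map_smul]
    exact mul_mem (A.algebraMap_mem r) (hx a)
  lie_mem' hx hy a := by
    rw [repr_baseChange_lie]
    exact sum_mem fun b _ => sum_mem fun c _ => A.smul_mem (mul_mem (hx b) (hy c)) _

variable {t} {A : Subalgebra F k} {x : k ⊗[F] g}

theorem coeffs_mono {B : Subalgebra F k} (hAB : A ≤ B) (hx : x ∈ coeffs t A) : x ∈ coeffs t B :=
  fun a => hAB (hx a)

theorem mapCoeff_mem_coeffs {φ : k →ₗ[F] k} (hφ : ∀ z, φ z ∈ A) (x : k ⊗[F] g) :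
    mapCoeff φ x ∈ coeffs t A := fun a => by
  rw [repr_mapCoeff]
  exact hφ _

theorem mapCoeff_eq_self {φ : k →ₗ[F] k} (hφ : ∀ z ∈ A, φ z = z) (hx : x ∈ coeffs t A) :
    mapCoeff φ x = x :=
  (t.baseChange k).repr.injective (Finsupp.ext fun a => by rw [repr_mapCoeff, hφ _ (hx a)])

theorem mapCoeff_eq_zero {φ : k →ₗ[F] k} (hφ : ∀ z ∈ A, φ z = 0) (hx : x ∈ coeffs t A) :
    mapCoeff φ x = 0 :=
  (t.baseChange k).repr.injective (Finsupp.ext fun a => by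
    rw [repr_mapCoeff, hφ _ (hx a), map_zero, Finsupp.zero_apply])

variable {K : IntermediateField F k} (φ : k →ₗ[K] k)

theorem mapCoeff_smul_of_mem_coeffs (hx : x ∈ coeffs t K.toSubalgebra) (c : k) :
    mapCoeff (φ.restrictScalars F) (c • x) = φ c • x := by
  refine (t.baseChange k).repr.injective (Finsupp.ext fun a => ?_)
  rw [repr_mapCoeff, map_smul, map_smul, Finsupp.smul_apply, Finsupp.smul_apply, smul_eq_mul,
    smul_eq_mul, mul_comm, mul_comm (φ c)]
  exact φ.map_smul (⟨_, hx a⟩ : K) c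

theorem mapCoeff_lie_of_mem_coeffs (hx : x ∈ coeffs t K.toSubalgebra) (y : k ⊗[F] g) :
    mapCoeff (φ.restrictScalars F) ⁅x, y⁆ = ⁅x, mapCoeff (φ.restrictScalars F) y⁆ := by
  refine (t.baseChange k).repr.injective (Finsupp.ext fun a => ?_)
  simp only [repr_mapCoeff, repr_baseChange_lie, map_sum, map_smul]
  exact Finset.sum_congr rfl fun b _ => Finset.sum_congr rfl fun c _ =>
    congrArg _ (φ.map_smul (⟨_, hx b⟩ : K) _)

end Coeffs

section Descent

variable {g : Type*} [LieRing g] [LieAlgebra F g] {ι : Type*} [Fintype ι]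
  {t : Module.Basis ι F g} {K : IntermediateField F k}

theorem exists_projection {A : Subalgebra F k} (hKA : K.toSubalgebra ≤ A) :
    ∃ π : k →ₗ[K] k, (∀ z, π z ∈ A) ∧ ∀ z ∈ A, π z = z := by
  let N : Submodule K k :=
    { A.toSubmodule with smul_mem' := fun c _ hx => mul_mem (hKA c.2) hx }
  obtain ⟨p, hp⟩ := LinearMap.exists_leftInverse_of_injective N.subtype N.ker_subtype
  exact ⟨N.subtype ∘ₗ p, fun z => (p z).2,
    fun z hz => congrArg Subtype.val (LinearMap.congr_fun hp ⟨z, hz⟩)⟩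

/-- Expanding the coefficients of `x ∈ N` on a basis of `k` over `K` writes `x` as a combination of
its images under the coordinate functions. -/
theorem span_inter_coeffs {N : Submodule k (k ⊗[F] g)}
    (hN : ∀ φ : k →ₗ[K] k, ∀ x ∈ N, mapCoeff (φ.restrictScalars F) x ∈ N) :
    Submodule.span k (N ∩ (coeffs t K.toSubalgebra : Set (k ⊗[F] g))) = N := by
  classical
  refine le_antisymm (Submodule.span_le.mpr Set.inter_subset_left) fun x hx => ?_
  let b := Module.Basis.ofVectorSpace K k
  let φ (i) : k →ₗ[K] k := Algebra.linearMap K k ∘ₗ b.coord i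
  let T := Finset.univ.biUnion fun a => (b.repr ((t.baseChange k).repr x a)).support
  have hsum : x = ∑ i ∈ T, b i • mapCoeff ((φ i).restrictScalars F) x := by
    refine (t.baseChange k).repr.injective (Finsupp.ext fun a => ?_)
    simp only [map_sum, map_smul, Finsupp.finsetSum_apply, Finsupp.smul_apply, smul_eq_mul,
      repr_mapCoeff]
    conv_lhs => rw [← b.linearCombination_repr ((t.baseChange k).repr x a)]
    rw [Finsupp.linearCombination_apply, Finsupp.sum_of_support_subset (s := T)]
    · exact Finset.sum_congr rfl fun i _ => (Algebra.smul_def _ _).trans (mul_comm _ _)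
    · exact Finset.subset_biUnion_of_mem
        (fun a => (b.repr ((t.baseChange k).repr x a)).support) (Finset.mem_univ a)
    · exact fun i _ => zero_smul _ _
  rw [hsum]
  exact sum_mem fun i _ => Submodule.smul_mem _ _ <| Submodule.subset_span
    ⟨hN _ x hx, mapCoeff_mem_coeffs (fun z => (b.coord i z).2) x⟩

theorem exists_basis_ker_ad_mem_coeffs [FiniteDimensional F g] {e : k ⊗[F] g}
    (he : e ∈ coeffs t K.toSubalgebra) :
    ∃ (n : ℕ) (ℓ : Fin n → k ⊗[F] g), LinearIndependent k ℓ ∧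
      Submodule.span k (Set.range ℓ) = LinearMap.ker (LieAlgebra.ad k (k ⊗[F] g) e) ∧
      ∀ s, ℓ s ∈ coeffs t K.toSubalgebra := by
  have hstable : ∀ φ : k →ₗ[K] k, ∀ x ∈ LinearMap.ker (LieAlgebra.ad k (k ⊗[F] g) e),
      mapCoeff (φ.restrictScalars F) x ∈ LinearMap.ker (LieAlgebra.ad k (k ⊗[F] g) e) := by
    intro φ x hx
    rw [LinearMap.mem_ker, LieAlgebra.ad_apply] at hx ⊢
    rw [← mapCoeff_lie_of_mem_coeffs φ he, hx, map_zero]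
  obtain ⟨ℓ, hℓ, hspan, hli⟩ := Submodule.exists_fun_fin_finrank_span_eq k
    (LinearMap.ker (LieAlgebra.ad k (k ⊗[F] g) e) ∩ (coeffs t K.toSubalgebra : Set (k ⊗[F] g)))
  exact ⟨_, ℓ, hli, hspan.trans (span_inter_coeffs hstable), fun s => (hℓ s).2⟩

variable [CharZero k] {h : g}

theorem exists_isSl2Triple_mem_coeffs [FiniteDimensional F g] [LieAlgebra.IsKilling F g]
    (hh : IsGradingElement ((1 : k) ⊗ₜ[F] h)) {f : k ⊗[F] g}
    (hf : f ∈ gradePiece k ((1 : k) ⊗ₜ[F] h) (-1)) (hf0 : f ≠ 0)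
    (hfK : f ∈ coeffs t K.toSubalgebra)
    (hinj : ∀ y ∈ gradePiece k ((1 : k) ⊗ₜ[F] h) 1, ⁅f, y⁆ = 0 → y = 0) :
    ∃ e ∈ gradePiece k ((1 : k) ⊗ₜ[F] h) 1, e ∈ coeffs t K.toSubalgebra ∧
      IsSl2Triple ⁅e, f⁆ e f := by
  obtain ⟨e, he, hfe⟩ := exists_lie_lie_eq_self hh (killingForm_baseChange_nondegenerate k) hf
  obtain ⟨π, hπ, hπK⟩ := exists_projection (le_refl K.toSubalgebra)
  have hπe : ⁅f, ⁅f, mapCoeff (π.restrictScalars F) e⁆⁆ = f := by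
    rw [← mapCoeff_lie_of_mem_coeffs π hfK, ← mapCoeff_lie_of_mem_coeffs π hfK, hfe]
    exact mapCoeff_eq_self hπK hfK
  have hmem := Submodule.smul_mem _ (-2 : k) (mapCoeff_mem_gradePiece (π.restrictScalars F) he)
  refine ⟨(-2 : k) • mapCoeff (π.restrictScalars F) e, hmem, fun a => ?_,
    isSl2Triple_of_lie_lie hf hf0 hmem (by rw [lie_smul, lie_smul, hπe]) hinj⟩
  rw [map_smul, Finsupp.smul_apply, smul_eq_mul]
  exact mul_mem (neg_mem (ofNat_mem _ 2)) (mapCoeff_mem_coeffs hπ e a)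

omit [Fintype ι] in
/-- Differentiating `⁅f, y⁆ = 0` gives `⁅t a, y⁆ = -⁅f, D y⁆`, hence `⁅y, ⁅y, t a⁆⁆ = 0`. -/
theorem eq_zero_of_lie_eq_zero_of_derivation [FiniteDimensional F g] [LieAlgebra.IsKilling F g]
    {d : ι → ℤ} (ht : IsGradedBasis t d h) {f : k ⊗[F] g}
    (hf : ∀ a, d a = -1 → ∃ D : Derivation F k k,
      mapCoeff (D : k →ₗ[F] k) f = (1 : k) ⊗ₜ[F] t a)
    {y : k ⊗[F] g} (hy : y ∈ gradePiece k ((1 : k) ⊗ₜ[F] h) 1) (hfy : ⁅f, y⁆ = 0) : y = 0 := by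
  have := FiniteDimensional.fintypeBasisIndex t
  have hh := (ht.baseChange k).isGradingElement
  have hyt : ∀ a, d a = -1 → ⁅y, ⁅y, (1 : k) ⊗ₜ[F] t a⁆⁆ = 0 := by
    intro a ha
    obtain ⟨D, hD⟩ := hf a ha
    have hleibniz := mapCoeff_derivation_lie D f y
    rw [hfy, map_zero, hD, ← lie_skew, eq_comm, neg_add_eq_zero] at hleibniz
    rw [hleibniz, leibniz_lie, ← lie_skew y f, hfy, neg_zero, zero_lie, zero_add,
      hh.lie_eq_zero one_ne_zero hy (mapCoeff_mem_gradePiece _ hy), lie_zero]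
  refine eq_zero_of_forall_lie_lie_eq_zero hh (killingForm_baseChange_nondegenerate k) hy
    fun x hx => ?_
  rw [(ht.baseChange k).mem_gradePiece_iff] at hx
  rw [← (t.baseChange k).sum_repr x, lie_sum, lie_sum]
  refine Finset.sum_eq_zero fun a _ => ?_
  by_cases ha : d a = -1
  · rw [Module.Basis.baseChange_apply, lie_smul, lie_smul, hyt a ha, smul_zero]
  · rw [hx a ha, zero_smul, lie_zero, lie_zero]

end Descent

section HighestWeightForm

variable {g : Type*} [LieRing g] [LieAlgebra F g] {ι : Type*} [Fintype ι]
  {t : Module.Basis ι F g} {K : IntermediateField F k} {S : Type*} [Fintype S]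
  {ℓ : S → k ⊗[F] g} {W : S → k}

theorem apply_mem_of_sum_smul_mem_coeffs (hli : LinearIndependent k ℓ)
    (hℓK : ∀ s, ℓ s ∈ coeffs t K.toSubalgebra) {A : Subalgebra F k} (hKA : K.toSubalgebra ≤ A)
    (hW : ∑ s, W s • ℓ s ∈ coeffs t A) (s : S) : W s ∈ A := by
  obtain ⟨π, hπ, hπA⟩ := exists_projection hKA
  have hsum : ∑ s, π (W s) • ℓ s = ∑ s, W s • ℓ s := by
    rw [← mapCoeff_eq_self (φ := π.restrictScalars F) hπA hW, map_sum]
    exact Finset.sum_congr rfl fun s _ => (mapCoeff_smul_of_mem_coeffs π (hℓK s) _).symm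
  rw [← congrFun (hli.fintypeLinearCombination_injective hsum) s]
  exact hπ _

theorem derivation_apply_eq_zero_of_mapCoeff_sum_eq_zero (hli : LinearIndependent k ℓ)
    (hℓK : ∀ s, ℓ s ∈ coeffs t K.toSubalgebra) {D : Derivation F k k} (hDK : ∀ z ∈ K, D z = 0)
    (hW : mapCoeff (D : k →ₗ[F] k) (∑ s, W s • ℓ s) = 0) (s : S) : D (W s) = 0 := by
  refine Fintype.linearIndependent_iff.mp hli (fun s => D (W s)) ?_ s
  rw [← hW, map_sum]
  refine Finset.sum_congr rfl fun s _ => ?_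
  rw [mapCoeff_derivation_smul, mapCoeff_eq_zero hDK (hℓK s), smul_zero, add_zero]

namespace IsSliceTriple

variable [CharZero k] {h : g} {T e f : k ⊗[F] g} (hs : IsSliceTriple k ((1 : k) ⊗ₜ[F] h) T e f)
  {c x : k ⊗[F] g} (hc : c ∈ gradePiece k ((1 : k) ⊗ₜ[F] h) 1)

include hs hc

variable (heK : e ∈ coeffs t K.toSubalgebra) (hfK : f ∈ coeffs t K.toSubalgebra)
  (hcf : ⁅e, ⁅c, f⁆⁆ = ⁅e, x - f⁆)

include heK hfK hcf

theorem mem_coeffs_of_lie_lie_eq {A : Subalgebra F k} (hKA : K.toSubalgebra ≤ A)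
    (hxA : x ∈ coeffs t A) : c ∈ coeffs t A := by
  obtain ⟨π, hπ, hπA⟩ := exists_projection hKA
  have hπx : mapCoeff (π.restrictScalars F) (x - f) = x - f :=
    mapCoeff_eq_self hπA (sub_mem hxA (coeffs_mono hKA hfK))
  have hπc : mapCoeff (π.restrictScalars F) c = c := by
    refine hs.eq_of_lie_lie_eq (mapCoeff_mem_gradePiece _ hc) hc ?_
    rw [hcf, ← hπx, ← mapCoeff_lie_of_mem_coeffs π heK, ← hcf, mapCoeff_lie_of_mem_coeffs π heK,
      ← lie_skew c f, map_neg, mapCoeff_lie_of_mem_coeffs π hfK, lie_skew]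
  rw [← hπc]
  exact mapCoeff_mem_coeffs hπ c

theorem mapCoeff_derivation_eq_neg {D : Derivation F k k} (hDK : ∀ z ∈ K, D z = 0)
    {v : k ⊗[F] g} (hv : v ∈ gradePiece k ((1 : k) ⊗ₜ[F] h) 1)
    (hx : x - f ∈ gradePiece k ((1 : k) ⊗ₜ[F] h) 0 ⊔ gradePiece k ((1 : k) ⊗ₜ[F] h) 1)
    (hDx : mapCoeff (D : k →ₗ[F] k) x = -⁅v, x⁆) : mapCoeff (D : k →ₗ[F] k) c = -v := by
  have hDe : mapCoeff (D : k →ₗ[F] k) e = 0 := mapCoeff_eq_zero hDK heK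
  have hDf : mapCoeff (D : k →ₗ[F] k) f = 0 := mapCoeff_eq_zero hDK hfK
  have hvx : ⁅e, ⁅v, x⁆⁆ = ⁅e, ⁅v, f⁆⁆ := by
    rw [← sub_eq_zero, ← lie_sub, ← lie_sub]
    exact hs.isGradingElement.lie_lie_eq_zero one_ne_zero hs.e_mem hv hx
  refine hs.eq_of_lie_lie_eq (mapCoeff_mem_gradePiece _ hc) (neg_mem hv) ?_
  have hDcf := congrArg (mapCoeff (D : k →ₗ[F] k)) hcf
  simp only [mapCoeff_derivation_lie, hDe, hDf, zero_lie, lie_zero, zero_add, add_zero, map_sub,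
    sub_zero, hDx, lie_neg, hvx] at hDcf
  rw [hDcf, neg_lie, lie_neg]

end IsSliceTriple

variable [CharZero k] [Algebra ℚ k] {h : g} {c x : k ⊗[F] g}

theorem conjExp_eq_smul (hh : IsGradingElement ((1 : k) ⊗ₜ[F] h))
    (hc : c ∈ gradePiece k ((1 : k) ⊗ₜ[F] h) 1) :
    conjExp k c x = x - ⁅c, x⁆ + (2 : F)⁻¹ • ⁅c, ⁅c, x⁆⁆ := by
  rw [hh.conjExp_apply hc, ← algebraMap_smul k (2 : F)⁻¹, map_inv₀, map_ofNat]

theorem conjExp_mem_coeffs (hh : IsGradingElement ((1 : k) ⊗ₜ[F] h))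
    (hc : c ∈ gradePiece k ((1 : k) ⊗ₜ[F] h) 1) {A : Subalgebra F k} (hcA : c ∈ coeffs t A)
    (hxA : x ∈ coeffs t A) : conjExp k c x ∈ coeffs t A := by
  have hcx := (coeffs t A).lie_mem hcA hxA
  rw [conjExp_eq_smul hh hc]
  exact add_mem (sub_mem hxA hcx) ((coeffs t A).smul_mem _ ((coeffs t A).lie_mem hcA hcx))

theorem mapCoeff_derivation_conjExp (hh : IsGradingElement ((1 : k) ⊗ₜ[F] h))
    (hc : c ∈ gradePiece k ((1 : k) ⊗ₜ[F] h) 1) {v : k ⊗[F] g}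
    (hv : v ∈ gradePiece k ((1 : k) ⊗ₜ[F] h) 1) {D : Derivation F k k}
    (hDc : mapCoeff (D : k →ₗ[F] k) c = -v) (hDx : mapCoeff (D : k →ₗ[F] k) x = -⁅v, x⁆) :
    mapCoeff (D : k →ₗ[F] k) (conjExp k c x) = 0 := by
  have hvc : ⁅v, ⁅c, x⁆⁆ = ⁅c, ⁅v, x⁆⁆ :=
    lie_comm_of_lie_eq_zero (hh.lie_eq_zero one_ne_zero hv hc) x
  have hccv : ⁅c, ⁅c, ⁅v, x⁆⁆⁆ = 0 := hh.lie_lie_lie_eq_zero one_ne_zero hc hc hv x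
  have htwo (y : k ⊗[F] g) : (2 : F)⁻¹ • (y + y) = y := by
    rw [← two_smul F y, inv_smul_smul₀ fun h2 => two_ne_zero (α := k) <| by
      rw [← map_ofNat (algebraMap F k), h2, map_zero]]
  simp only [conjExp_eq_smul hh hc, map_add, map_sub, map_smul, mapCoeff_derivation_lie, hDc, hDx,
    neg_lie, lie_neg, lie_add, hvc, hccv, add_zero, ← neg_add, smul_neg, htwo]
  abel

namespace IsSliceTriple

variable {T e f : k ⊗[F] g}
  (hs : IsSliceTriple k ((1 : k) ⊗ₜ[F] h) T e f) (hc : c ∈ gradePiece k ((1 : k) ⊗ₜ[F] h) 1)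
  (hx : x - f ∈ gradePiece k ((1 : k) ⊗ₜ[F] h) 0 ⊔ gradePiece k ((1 : k) ⊗ₜ[F] h) 1)
  (heK : e ∈ coeffs t K.toSubalgebra) (hfK : f ∈ coeffs t K.toSubalgebra)
  (hli : LinearIndependent k ℓ) (hℓ : ∀ s, ⁅e, ℓ s⁆ = 0)
  (hℓK : ∀ s, ℓ s ∈ coeffs t K.toSubalgebra) (hW : conjExp k c x = f + ∑ s, W s • ℓ s)

include hs hc hx heK hfK hli hℓ hℓK hW

theorem apply_mem_of_conjExp_eq {A : Subalgebra F k} (hKA : K.toSubalgebra ≤ A)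
    (hxA : x ∈ coeffs t A) (s : S) : W s ∈ A := by
  refine apply_mem_of_sum_smul_mem_coeffs hli hℓK hKA ?_ s
  rw [← sub_eq_of_eq_add' hW]
  have hcA := hs.mem_coeffs_of_lie_lie_eq hc heK hfK (hs.lie_lie_eq_of_conjExp_eq hℓ hc hx hW)
    hKA hxA
  exact sub_mem (conjExp_mem_coeffs hs.isGradingElement hc hcA hxA) (coeffs_mono hKA hfK)

theorem derivation_apply_eq_zero_of_conjExp_eq {D : Derivation F k k} (hDK : ∀ z ∈ K, D z = 0)
    {v : k ⊗[F] g} (hv : v ∈ gradePiece k ((1 : k) ⊗ₜ[F] h) 1)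
    (hDx : mapCoeff (D : k →ₗ[F] k) x = -⁅v, x⁆) (s : S) : D (W s) = 0 := by
  refine derivation_apply_eq_zero_of_mapCoeff_sum_eq_zero hli hℓK hDK ?_ s
  have hDc := hs.mapCoeff_derivation_eq_neg hc heK hfK (hs.lie_lie_eq_of_conjExp_eq hℓ hc hx hW)
    hDK hv hx hDx
  rw [← sub_eq_of_eq_add' hW, map_sub,
    mapCoeff_derivation_conjExp hs.isGradingElement hc hv hDc hDx, mapCoeff_eq_zero hDK hfK,
    sub_zero]

end IsSliceTriple

end HighestWeightForm

end Coefficients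

section ExtendDerivation

variable {R A K : Type*} [CommRing R] [CommRing A] [Algebra R A] [Field K] [Algebra R K]
  [Algebra A K] [IsScalarTower R A K] [IsFractionRing A K]

/-- The extension to the fraction field `K` of a derivation of `A` with values in `K`. -/
def extendDerivation (D : Derivation R A K) : Derivation R K K :=
  haveI := Algebra.FormallyEtale.of_isLocalization (Rₘ := K) (nonZeroDivisors A)
  (D.liftKaehlerDifferential.liftBaseChange K ∘ₗ
    (KaehlerDifferential.tensorKaehlerEquivOfFormallyEtale R A K).symm.toLinearMap).compDer
      (KaehlerDifferential.D R K)

theorem extendDerivation_algebraMap (D : Derivation R A K) (a : A) :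
    extendDerivation D (algebraMap A K a) = D a := by
  simp [extendDerivation,
    KaehlerDifferential.tensorKaehlerEquivOfFormallyEtale_symm_D_algebraMap]

omit [Algebra R A] [IsScalarTower R A K] in
theorem derivation_ext_algebraMap {D D' : Derivation R K K}
    (hD : ∀ a, D (algebraMap A K a) = D' (algebraMap A K a)) : D = D' := by
  ext f
  obtain ⟨p, q, -, rfl⟩ := IsFractionRing.div_surjective (A := A) f
  rw [Derivation.leibniz_div, Derivation.leibniz_div, hD, hD]

end ExtendDerivation

section RationalFunctions

variable {ι : Type*} {d : ι → ℤ}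

theorem ofPoly_eq_aeval (P : MvPolynomial ι ℝ) : ofPoly P = MvPolynomial.aeval coordJ P :=
  (MvPolynomial.aeval_unique (IsScalarTower.toAlgHom ℝ (MvPolynomial ι ℝ) (RatFun ι)) ▸ rfl)

theorem ofNegPoly_eq_ofPoly (Q : MvPolynomial (Neg d) ℝ) :
    ofNegPoly d Q = ofPoly (MvPolynomial.rename Subtype.val Q) := by
  rw [ofPoly_eq_aeval, MvPolynomial.aeval_rename]
  rfl

theorem ofNegPoly_ne_zero {Q : MvPolynomial (Neg d) ℝ} (hQ : Q ≠ 0) : ofNegPoly d Q ≠ 0 := by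
  rw [ofNegPoly_eq_ofPoly, ofPoly, Ne, FaithfulSMul.algebraMap_eq_zero_iff,
    map_eq_zero_iff _ (MvPolynomial.rename_injective _ Subtype.val_injective)]
  exact hQ

/-- The field `ℝ(J_α)` of rational functions of the `J_α`, `α ∈ I₋`. -/
def negField (d : ι → ℤ) : IntermediateField ℝ (RatFun ι) :=
  IntermediateField.adjoin ℝ (Set.range fun α : Neg d => (coordJ α.1 : RatFun ι))

theorem mem_negField {f : RatFun ι} : f ∈ negField d ↔ f ∈ negRational d := by
  rw [negField, IntermediateField.mem_adjoin_range_iff]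
  constructor
  · rintro ⟨P, Q, rfl⟩
    by_cases hQ : Q = 0
    · exact ⟨0, 1, one_ne_zero, by simp [hQ, ofNegPoly]⟩
    · exact ⟨P, Q, hQ, rfl⟩
  · rintro ⟨P, Q, -, rfl⟩
    exact ⟨P, Q, rfl⟩

theorem coordJ_mem_negField (α : Neg d) : coordJ α.1 ∈ negField d :=
  IntermediateField.subset_adjoin _ _ ⟨α, rfl⟩

theorem aeval_mem_of_forall_mem {σ A : Type*} [CommRing A] [Algebra ℝ A] {B : Subalgebra ℝ A}
    {v : σ → A} (hv : ∀ s, v s ∈ B) (P : MvPolynomial σ ℝ) : MvPolynomial.aeval v P ∈ B := by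
  have hP : MvPolynomial.aeval v P ∈ Algebra.adjoin ℝ (Set.range v) := by
    rw [Algebra.adjoin_range_eq_range_aeval]
    exact ⟨P, rfl⟩
  exact Algebra.adjoin_le (Set.range_subset_iff.mpr hv) hP

theorem ofNegPoly_mem_negField (Q : MvPolynomial (Neg d) ℝ) : ofNegPoly d Q ∈ negField d :=
  aeval_mem_of_forall_mem (B := (negField d).toSubalgebra) coordJ_mem_negField Q

variable {S : Type*} {W : S → RatFun ι}

/-- The enlarged `W`-algebra: the functions `P(W_s, J_α)/Q(J_α)`, as a subalgebra of `ℝ(J)`. -/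
def wSubalgebra (d : ι → ℤ) (W : S → RatFun ι) : Subalgebra ℝ (RatFun ι) where
  carrier := wAlgebra d W
  add_mem' := by
    rintro _ _ ⟨P, Q, hQ, rfl⟩ ⟨P', Q', hQ', rfl⟩
    refine ⟨P * MvPolynomial.rename Sum.inr Q' + MvPolynomial.rename Sum.inr Q * P', Q * Q',
      mul_ne_zero hQ hQ', ?_⟩
    rw [div_add_div _ _ (ofNegPoly_ne_zero hQ) (ofNegPoly_ne_zero hQ')]
    simp [ofNegPoly, MvPolynomial.aeval_rename, Function.comp_def]
  mul_mem' := by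
    rintro _ _ ⟨P, Q, hQ, rfl⟩ ⟨P', Q', hQ', rfl⟩
    refine ⟨P * P', Q * Q', mul_ne_zero hQ hQ', ?_⟩
    rw [div_mul_div_comm]
    simp [ofNegPoly]
  algebraMap_mem' r := ⟨MvPolynomial.C r, 1, one_ne_zero, by simp [ofNegPoly]⟩

theorem negField_le_wSubalgebra : (negField d).toSubalgebra ≤ wSubalgebra d W := by
  intro f hf
  obtain ⟨P, Q, hQ, rfl⟩ := mem_negField.mp hf
  exact ⟨MvPolynomial.rename Sum.inr P, Q, hQ, by
    simp [ofNegPoly, MvPolynomial.aeval_rename, Function.comp_def]⟩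

theorem apply_mem_wSubalgebra (s : S) : W s ∈ wSubalgebra d W :=
  ⟨MvPolynomial.X (Sum.inl s), 1, one_ne_zero, by simp [ofNegPoly]⟩

theorem wSubalgebra_le {B : Subalgebra ℝ (RatFun ι)} (hW : ∀ s, W s ∈ B)
    (hB : (negField d).toSubalgebra ≤ B) : wSubalgebra d W ≤ B := by
  rintro _ ⟨P, Q, -, rfl⟩
  rw [div_eq_mul_inv]
  exact mul_mem (aeval_mem_of_forall_mem (Sum.rec hW fun α => hB (coordJ_mem_negField α)) P)
    (hB <| (negField d).inv_mem <| ofNegPoly_mem_negField Q)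

theorem coe_wSubalgebra_coordJ : (wSubalgebra d coordJ : Set (RatFun ι)) = polyOverNeg d := by
  ext f
  constructor
  · rintro ⟨P, Q, hQ, rfl⟩
    refine ⟨MvPolynomial.aeval (Sum.elim MvPolynomial.X fun α : Neg d => MvPolynomial.X α.1) P, Q,
      hQ, ?_⟩
    congr 1
    rw [ofPoly_eq_aeval, MvPolynomial.comp_aeval_apply]
    congr 2
    funext s
    rcases s with a | α <;> simp
  · rintro ⟨P, Q, hQ, rfl⟩
    refine ⟨MvPolynomial.rename Sum.inl P, Q, hQ, ?_⟩
    rw [ofPoly_eq_aeval, MvPolynomial.aeval_rename]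
    rfl

theorem mem_polyOverNeg {f : RatFun ι} : f ∈ polyOverNeg d ↔ f ∈ wSubalgebra d coordJ := by
  rw [← coe_wSubalgebra_coordJ, SetLike.mem_coe]

/-- The partial derivative `∂/∂J_a`, as a derivation. -/
def partialDer (a : ι) : Derivation ℝ (RatFun ι) (RatFun ι) :=
  extendDerivation ((Algebra.linearMap (MvPolynomial ι ℝ) (RatFun ι)).compDer
    (MvPolynomial.pderiv a))

theorem partialDer_ofPoly (a : ι) (P : MvPolynomial ι ℝ) :
    partialDer a (ofPoly P) = ofPoly (MvPolynomial.pderiv a P) :=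
  extendDerivation_algebraMap _ P

theorem partialDer_ofPoly_div (a : ι) (P Q : MvPolynomial ι ℝ) :
    partialDer a (ofPoly P / ofPoly Q) =
      ofPoly (MvPolynomial.pderiv a P * Q - P * MvPolynomial.pderiv a Q) / ofPoly (Q ^ 2) := by
  rw [Derivation.leibniz_div, partialDer_ofPoly, partialDer_ofPoly, smul_eq_mul, smul_eq_mul,
    smul_eq_mul, ofPoly, ofPoly, ofPoly, ofPoly, ofPoly, ofPoly, map_sub, map_mul, map_mul, map_pow,
    inv_pow, div_eq_inv_mul, mul_comm (algebraMap _ _ Q)]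

theorem partialJ_eq_partialDer (a : ι) (f : RatFun ι) : partialJ a f = partialDer a f := by
  conv_rhs => rw [← IsFractionRing.mk'_num_den' (MvPolynomial ι ℝ) f]
  exact (partialDer_ofPoly_div a _ _).symm

theorem partialDer_coordJ [DecidableEq ι] (a b : ι) :
    partialDer a (coordJ b) = if a = b then (1 : RatFun ι) else 0 := by
  rw [coordJ, partialDer_ofPoly, MvPolynomial.pderiv_X, Pi.single_apply]
  simp only [eq_comm]
  split_ifs <;> simp [ofPoly]

theorem partialDer_mem_polyOverNeg (a : ι) {f : RatFun ι} (hf : f ∈ polyOverNeg d) :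
    partialDer a f ∈ polyOverNeg d := by
  obtain ⟨P, Q, hQ, rfl⟩ := hf
  rw [ofNegPoly_eq_ofPoly, partialDer_ofPoly_div]
  refine ⟨MvPolynomial.pderiv a P * MvPolynomial.rename Subtype.val Q -
    P * MvPolynomial.pderiv a (MvPolynomial.rename Subtype.val Q), Q ^ 2, pow_ne_zero 2 hQ, ?_⟩
  rw [ofNegPoly_eq_ofPoly, map_pow]

theorem derivation_ext_coordJ {D D' : Derivation ℝ (RatFun ι) (RatFun ι)}
    (hD : ∀ a, D (coordJ a) = D' (coordJ a)) : D = D' :=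
  derivation_ext_algebraMap (A := MvPolynomial ι ℝ) <| DFunLike.congr_fun <|
    MvPolynomial.derivation_ext (D₁ := D.compAlgebraMap (MvPolynomial ι ℝ))
      (D₂ := D'.compAlgebraMap (MvPolynomial ι ℝ)) hD

theorem derivation_eq_zero_of_mem_negField {D : Derivation ℝ (RatFun ι) (RatFun ι)}
    (hD : ∀ α : Neg d, D (coordJ α.1) = 0) {f : RatFun ι} (hf : f ∈ negField d) : D f = 0 := by
  have hpoly (P : MvPolynomial (Neg d) ℝ) : D (ofNegPoly d P) = 0 := by
    refine Derivation.eqOn_adjoin (D1 := D) (D2 := 0) (Set.forall_mem_range.mpr hD) ?_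
    rw [SetLike.mem_coe, Algebra.adjoin_range_eq_range_aeval]
    exact ⟨P, rfl⟩
  obtain ⟨P, Q, -, rfl⟩ := mem_negField.mp hf
  rw [Derivation.leibniz_div_const _ _ _ (hpoly Q), hpoly, smul_zero]

end RationalFunctions

section InvariantPolynomials

variable {k M ι : Type*} [Field k] [LieRing M] [LieAlgebra k M] [Fintype ι]
  (t : Module.Basis ι k M)

theorem repr_lie_eq_sum (c x : M) (a : ι) :
    t.repr ⁅c, x⁆ a = ∑ b, t.repr ⁅c, t b⁆ a * t.repr x b := by
  conv_lhs => rw [← t.sum_repr x, lie_sum]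
  simp [mul_comm]

/-- The derivative of polynomial functions along the vector field `x ↦ -[c, x]` on `M`, in the
coordinates of the basis `t`. -/
def adDer : M →ₗ[k] Derivation k (MvPolynomial ι k) (MvPolynomial ι k) where
  toFun c := MvPolynomial.mkDerivation k fun a => -∑ b, t.repr ⁅c, t b⁆ a • MvPolynomial.X b
  map_add' c c' := MvPolynomial.derivation_ext fun a => by
    simp [MvPolynomial.mkDerivation_X, add_smul, Finset.sum_add_distrib, add_comm]
  map_smul' r c := MvPolynomial.derivation_ext fun a => by
    simp [MvPolynomial.mkDerivation_X, mul_smul, Finset.smul_sum]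

theorem adDer_X (c : M) (a : ι) :
    adDer t c (MvPolynomial.X a) = -∑ b, t.repr ⁅c, t b⁆ a • MvPolynomial.X b :=
  MvPolynomial.mkDerivation_X k _ a

/-- The restriction of polynomial functions to the curve `r ↦ exp (-r ad c) x`, for `c` with
`(ad c)³ = 0`, as polynomials in the time `r`. -/
def restrictCurve (c x : M) : MvPolynomial ι k →ₐ[k] Polynomial k :=
  MvPolynomial.aeval fun a => Polynomial.C (t.repr x a) -
    Polynomial.X * Polynomial.C (t.repr ⁅c, x⁆ a) +
    Polynomial.X ^ 2 * Polynomial.C (2⁻¹ * t.repr ⁅c, ⁅c, x⁆⁆ a)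

theorem restrictCurve_adDer_X {c x : M} (hc : ⁅c, ⁅c, ⁅c, x⁆⁆⁆ = 0) (a : ι) :
    restrictCurve t c x (adDer t c (MvPolynomial.X a)) =
      Polynomial.X * Polynomial.C (t.repr ⁅c, ⁅c, x⁆⁆ a) - Polynomial.C (t.repr ⁅c, x⁆ a) := by
  have hcubic : ∑ b, t.repr ⁅c, t b⁆ a * t.repr ⁅c, ⁅c, x⁆⁆ b = 0 := by
    rw [← repr_lie_eq_sum, hc, map_zero, Finsupp.zero_apply]
  have hsum : restrictCurve t c x (adDer t c (MvPolynomial.X a)) =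
      -(Polynomial.C (∑ b, t.repr ⁅c, t b⁆ a * t.repr x b) -
        Polynomial.X * Polynomial.C (∑ b, t.repr ⁅c, t b⁆ a * t.repr ⁅c, x⁆ b) +
        Polynomial.X ^ 2 *
          Polynomial.C (2⁻¹ * ∑ b, t.repr ⁅c, t b⁆ a * t.repr ⁅c, ⁅c, x⁆⁆ b)) := by
    simp only [adDer_X, restrictCurve, map_neg, map_sum, map_smul, MvPolynomial.aeval_X,
      Finset.mul_sum, ← Finset.sum_sub_distrib, ← Finset.sum_add_distrib,
      Polynomial.smul_eq_C_mul, map_mul]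
    congr 1
    refine Finset.sum_congr rfl fun b _ => ?_
    ring
  rw [hsum, hcubic, ← repr_lie_eq_sum, ← repr_lie_eq_sum]
  simp

variable {t} {h c x : M} {P : MvPolynomial ι k}

omit [Fintype ι] in
theorem eval_zero_restrictCurve :
    (restrictCurve t c x P).eval 0 = MvPolynomial.eval (fun a => t.repr x a) P := by
  have hcomp : (Polynomial.aeval 0).comp (restrictCurve t c x) =
      MvPolynomial.aeval fun a => t.repr x a :=
    MvPolynomial.algHom_ext fun a => by simp [restrictCurve]
  rw [← Polynomial.coe_aeval_eq_eval, ← MvPolynomial.coe_aeval_eq_eval]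
  exact DFunLike.congr_fun hcomp P

variable [CharZero k]

theorem derivative_restrictCurve (hc : ⁅c, ⁅c, ⁅c, x⁆⁆⁆ = 0) (P : MvPolynomial ι k) :
    Polynomial.derivative (restrictCurve t c x P) = restrictCurve t c x (adDer t c P) := by
  induction P using MvPolynomial.induction_on with
  | C r => simp [MvPolynomial.derivation_C]
  | add P Q hP hQ => simp only [map_add, hP, hQ]
  | mul_X P a hP =>
    have hX : Polynomial.derivative (restrictCurve t c x (MvPolynomial.X a)) =
        restrictCurve t c x (adDer t c (MvPolynomial.X a)) := by
      rw [restrictCurve_adDer_X t hc]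
      have htwo : (Polynomial.C 2⁻¹ : Polynomial k) * (1 + 1) = 1 := by
        rw [one_add_one_eq_two, ← Polynomial.C_ofNat, ← Polynomial.C_mul,
          inv_mul_cancel₀ two_ne_zero, Polynomial.C_1]
      simp only [restrictCurve, MvPolynomial.aeval_X, map_add, map_sub, pow_two, zero_sub,
        Polynomial.derivative_mul, Polynomial.derivative_C, Polynomial.derivative_X, mul_zero,
        add_zero, one_mul, mul_one, map_mul]
      linear_combination Polynomial.X * Polynomial.C (t.repr ⁅c, ⁅c, x⁆⁆ a) * htwo
    simp only [map_mul, Polynomial.derivative_mul, Derivation.leibniz, map_add, smul_eq_mul, hP, hX]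
    ring

omit [Fintype ι] in
theorem eval_restrictCurve [Algebra ℚ k] (hh : IsGradingElement h) (hc : c ∈ gradePiece k h 1)
    (r : k) :
    (restrictCurve t c x P).eval r =
      MvPolynomial.eval (fun a => t.repr (conjExp k (r • c) x) a) P := by
  have hcomp : (Polynomial.aeval r).comp (restrictCurve t c x) =
      MvPolynomial.aeval fun a => t.repr (conjExp k (r • c) x) a :=
    MvPolynomial.algHom_ext fun a => by
      simp [restrictCurve, hh.conjExp_apply (Submodule.smul_mem _ r hc)]
      ring
  rw [← Polynomial.coe_aeval_eq_eval, ← MvPolynomial.coe_aeval_eq_eval]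
  exact DFunLike.congr_fun hcomp P

theorem adDer_eq_zero_iff [Algebra ℚ k] (hh : IsGradingElement h) (hc : c ∈ gradePiece k h 1) :
    adDer t c P = 0 ↔ ∀ (r : k) (x : M),
      MvPolynomial.eval (fun a => t.repr (conjExp k (r • c) x) a) P =
        MvPolynomial.eval (fun a => t.repr x a) P := by
  have hderiv (x : M) := derivative_restrictCurve (t := t)
    (hh.lie_lie_lie_eq_zero one_ne_zero hc hc hc x) P
  constructor
  · intro hP r x
    have hconst := Polynomial.eq_C_of_natDegree_eq_zero
      (Polynomial.derivative_eq_zero.mp <| (hderiv x).trans (by rw [hP, map_zero]))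
    rw [← eval_restrictCurve hh hc, ← eval_zero_restrictCurve (c := c), hconst]
    simp
  · intro hP
    refine MvPolynomial.funext fun z => ?_
    have hconst : restrictCurve t c (∑ b, z b • t b) P = Polynomial.C (MvPolynomial.eval z P) :=
      Polynomial.funext fun r => by
        rw [eval_restrictCurve hh hc, hP, t.repr_sum_self, Polynomial.eval_C]
    have hzero := congrArg (Polynomial.eval 0) (hderiv (∑ b, z b • t b))
    rw [hconst, Polynomial.derivative_C, eval_zero_restrictCurve, t.repr_sum_self,
      Polynomial.eval_zero] at hzero
    rw [← hzero, map_zero]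

end InvariantPolynomials

section InvariantPolynomialsBaseChange

variable {F k g ι : Type*} [Field F] [Field k] [Algebra F k] [LieRing g] [LieAlgebra F g]
  [Fintype ι] {t : Module.Basis ι F g}

theorem repr_one_tmul_lie (u : g) (x : k ⊗[F] g) (a : ι) :
    (t.baseChange k).repr ⁅(1 : k) ⊗ₜ[F] u, x⁆ a =
      ∑ b, t.repr ⁅u, t b⁆ a • (t.baseChange k).repr x b := by
  rw [repr_lie_eq_sum]
  simp [LieAlgebra.ExtendScalars.bracket_tmul, Algebra.smul_def]

theorem map_adDer (u : g) (P : MvPolynomial ι F) :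
    MvPolynomial.map (algebraMap F k) (adDer t u P) =
      adDer (t.baseChange k) ((1 : k) ⊗ₜ[F] u) (MvPolynomial.map (algebraMap F k) P) := by
  induction P using MvPolynomial.induction_on with
  | C r => simp [MvPolynomial.derivation_C]
  | add P Q hP hQ => simp only [map_add, hP, hQ]
  | mul_X P a hP =>
    have hX : MvPolynomial.map (algebraMap F k) (adDer t u (MvPolynomial.X a)) =
        adDer (t.baseChange k) ((1 : k) ⊗ₜ[F] u) (MvPolynomial.X a) := by
      simp [adDer_X, LieAlgebra.ExtendScalars.bracket_tmul, Algebra.smul_def]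
    simp only [map_mul, Derivation.leibniz, map_add, smul_eq_mul, hP, MvPolynomial.map_X, hX]

theorem aeval_conjExp_of_adDer_eq_zero [CharZero F] [Algebra ℚ k] {h : g} {d : ι → ℤ}
    (ht : IsGradedBasis t d h) {P : MvPolynomial ι F}
    (hP : ∀ u ∈ gradePiece F h 1, adDer t u P = 0) {c : k ⊗[F] g}
    (hc : c ∈ gradePiece k ((1 : k) ⊗ₜ[F] h) 1) (x : k ⊗[F] g) :
    MvPolynomial.aeval (fun a => (t.baseChange k).repr (conjExp k c x) a) P =
      MvPolynomial.aeval (fun a => (t.baseChange k).repr x a) P := by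
  have : CharZero k := charZero_of_injective_algebraMap (algebraMap F k).injective
  have hker : ∀ v ∈ (gradePiece F h 1).baseChange k,
      adDer (t.baseChange k) v (MvPolynomial.map (algebraMap F k) P) = 0 := by
    intro v hv
    rw [Submodule.baseChange_eq_span] at hv
    induction hv using Submodule.span_induction with
    | mem v hv =>
      obtain ⟨u, hu, rfl⟩ := hv
      rw [TensorProduct.mk_apply, ← map_adDer, hP u hu, map_zero]
    | zero => simp
    | add v w _ _ hv hw => simp [hv, hw]
    | smul r v _ hv => simp [hv]
  have hinv := (adDer_eq_zero_iff (ht.baseChange k).isGradingElement hc).mp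
    (hker c (ht.baseChange_gradePiece k 1 ▸ hc)) 1 x
  simpa only [one_smul, MvPolynomial.eval_map, MvPolynomial.aeval_def] using hinv

end InvariantPolynomialsBaseChange

section LiePoisson

variable {ι g : Type*} [Fintype ι] [LieRing g] [LieAlgebra ℝ g]
  (V : Type*) [AddCommGroup V] [Module ℝ V] [LieRingModule g V] [LieModule ℝ g V]
  (t : Module.Basis ι ℝ g)

/-- The linear function `X ↦ tr_V (u X)` on `g`, as a rational function of the coordinates. -/
def linJ : g →ₗ[ℝ] RatFun ι :=
  ∑ c, ((LieModule.traceForm ℝ g V).flip (t c)).smulRight (coordJ c)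

variable {V}

theorem repr_jTot (a : ι) : (t.baseChange (RatFun ι)).repr (jTot t) a = coordJ a := by
  simp [jTot, Module.Basis.baseChange_repr_tmul]

theorem linJ_apply (u : g) :
    linJ V t u = ∑ c, LieModule.traceForm ℝ g V u (t c) • coordJ c := by
  simp [linJ]

theorem linJ_mem_wSubalgebra (d : ι → ℤ) (u : g) : linJ V t u ∈ wSubalgebra d coordJ := by
  rw [linJ_apply]
  exact sum_mem fun c _ => Subalgebra.smul_mem _ (apply_mem_wSubalgebra c) _

theorem partialDer_linJ (a : ι) (u : g) :
    partialDer a (linJ V t u) = algebraMap ℝ (RatFun ι) (LieModule.traceForm ℝ g V u (t a)) := by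
  classical
  simp [linJ_apply, partialDer_coordJ, Algebra.smul_def]

variable [DecidableEq ι]

theorem poisson_eq_sum_partialDer (f h : RatFun ι) :
    poisson V t f h =
      ∑ a, ∑ b, partialDer a f * partialDer b h * linJ V t ⁅lowered V t a, lowered V t b⁆ := by
  simp only [poisson, partialJ_eq_partialDer, linJ_apply, Algebra.smul_def, structLow]

theorem poisson_skew (f h : RatFun ι) : poisson V t f h = -poisson V t h f := by
  rw [poisson_eq_sum_partialDer, poisson_eq_sum_partialDer, Finset.sum_comm,
    ← Finset.sum_neg_distrib]
  refine Finset.sum_congr rfl fun b _ => ?_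
  rw [← Finset.sum_neg_distrib]
  refine Finset.sum_congr rfl fun a _ => ?_
  rw [← lie_skew, map_neg, mul_neg, mul_comm (partialDer a f)]

variable (V) in
/-- The Hamiltonian derivation `{f, ·}`. -/
def poissonDer (f : RatFun ι) : Derivation ℝ (RatFun ι) (RatFun ι) :=
  ∑ a, ∑ b, (partialDer a f * linJ V t ⁅lowered V t a, lowered V t b⁆) • partialDer b

theorem poissonDer_apply (f h : RatFun ι) : poissonDer V t f h = poisson V t f h := by
  rw [poissonDer, poisson_eq_sum_partialDer, ← Derivation.coeFnAddMonoidHom_apply]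
  simp only [map_sum, Finset.sum_apply, Derivation.coeFnAddMonoidHom_apply, Derivation.coe_smul,
    Pi.smul_apply, smul_eq_mul, mul_right_comm]

theorem poisson_mem_polyOverNeg {d : ι → ℤ} {f h : RatFun ι} (hf : f ∈ polyOverNeg d)
    (hh : h ∈ polyOverNeg d) : poisson V t f h ∈ polyOverNeg d := by
  rw [poisson_eq_sum_partialDer, mem_polyOverNeg]
  exact sum_mem fun a _ => sum_mem fun b _ => mul_mem
    (mul_mem (mem_polyOverNeg.mp (partialDer_mem_polyOverNeg a hf))
      (mem_polyOverNeg.mp (partialDer_mem_polyOverNeg b hh)))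
    (linJ_mem_wSubalgebra t d _)

section Lowered

variable (hV : (LieModule.traceForm ℝ g V).Nondegenerate)

include hV

theorem traceForm_lowered (a : ι) (x : g) :
    LieModule.traceForm ℝ g V (lowered V t a) x = t.repr x a := by
  have hmetric : LinearMap.BilinForm.toMatrix t (LieModule.traceForm ℝ g V) = metric V t := by
    ext i j
    rw [LinearMap.BilinForm.toMatrix_apply, metric, Matrix.of_apply]
  have hdet : IsUnit (metric V t).det := isUnit_iff_ne_zero.mpr <|
    hmetric ▸ (LinearMap.BilinForm.nondegenerate_iff_det_ne_zero t).mp hV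
  have hbasis (b : ι) : LieModule.traceForm ℝ g V (lowered V t a) (t b) = t.repr (t b) a := by
    have hinv := congr_fun₂ (Matrix.nonsing_inv_mul _ hdet) a b
    simpa [Matrix.mul_apply, metric, lowered, Matrix.one_apply, Finsupp.single_apply,
      eq_comm] using hinv
  exact DFunLike.congr_fun (t.ext hbasis : LieModule.traceForm ℝ g V (lowered V t a) = t.coord a) x

theorem linJ_lowered (a : ι) : linJ V t (lowered V t a) = coordJ a := by
  simp [linJ_apply, traceForm_lowered t hV, Finsupp.single_apply]

theorem sum_traceForm_smul_lowered (u : g) :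
    ∑ a, LieModule.traceForm ℝ g V u (t a) • lowered V t a = u := by
  rw [← sub_eq_zero]
  refine hV.1 _ fun y => ?_
  simp only [map_sub, map_sum, map_smul, LinearMap.sub_apply, LinearMap.sum_apply,
    LinearMap.smul_apply, traceForm_lowered t hV, smul_eq_mul, sub_eq_zero]
  conv_rhs => rw [← t.sum_repr y]
  simp only [map_sum, map_smul, smul_eq_mul, mul_comm]

theorem poisson_linJ (u v : g) : poisson V t (linJ V t u) (linJ V t v) = linJ V t ⁅u, v⁆ := by
  conv_rhs => rw [← sum_traceForm_smul_lowered t hV u, ← sum_traceForm_smul_lowered t hV v]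
  simp only [poisson_eq_sum_partialDer, partialDer_linJ, sum_lie, lie_sum, smul_lie, lie_smul,
    map_sum, map_smul, Finset.smul_sum, Algebra.smul_def]
  rw [Finset.sum_comm]
  refine Finset.sum_congr rfl fun a _ => Finset.sum_congr rfl fun b _ => ?_
  ring

theorem poisson_linJ_coordJ (u : g) (a : ι) :
    poisson V t (linJ V t u) (coordJ a) = -∑ b, t.repr ⁅u, t b⁆ a • coordJ b := by
  rw [← linJ_lowered t hV, poisson_linJ t hV, ← lie_skew, map_neg, linJ_apply]
  simp only [LieModule.traceForm_apply_lie_apply, traceForm_lowered t hV]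

theorem mapCoeff_poissonDer_linJ_jTot (u : g) :
    mapCoeff (poissonDer V t (linJ V t u) : RatFun ι →ₗ[ℝ] RatFun ι) (jTot t) =
      -⁅(1 : RatFun ι) ⊗ₜ[ℝ] u, jTot t⁆ := by
  refine (t.baseChange (RatFun ι)).repr.injective (Finsupp.ext fun a => ?_)
  rw [repr_mapCoeff, map_neg, Finsupp.neg_apply, repr_one_tmul_lie, Derivation.coeFn_coe,
    repr_jTot, poissonDer_apply, poisson_linJ_coordJ t hV]
  simp only [repr_jTot]

theorem lowered_mem_gradePiece {h : g} {d : ι → ℤ} (ht : IsGradedBasis t d h) (a : ι) :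
    lowered V t a ∈ gradePiece ℝ h (-d a) := by
  rw [mem_gradePiece, ← sub_eq_zero]
  refine hV.1 _ fun y => ?_
  rw [map_sub, LinearMap.sub_apply, LieModule.traceForm_apply_lie_apply', map_smul,
    LinearMap.smul_apply, traceForm_lowered t hV, traceForm_lowered t hV, ht.repr_lie]
  simp

end Lowered

section Jacobi

variable {t} {f h k : RatFun ι}

theorem poisson_poisson_rotate
    (hE : poisson V t f (poisson V t h k) =
      poisson V t (poisson V t f h) k + poisson V t h (poisson V t f k)) :
    poisson V t k (poisson V t f h) =
      poisson V t (poisson V t k f) h + poisson V t f (poisson V t k h) := by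
  have hneg (a b : RatFun ι) : poisson V t a (-b) = -poisson V t a b := by
    rw [← poissonDer_apply, map_neg, poissonDer_apply]
  rw [poisson_skew t k (poisson V t f h), poisson_skew t (poisson V t k f) h, poisson_skew t k f,
    poisson_skew t k h, hneg, hneg, hE]
  abel

theorem poisson_poisson_of_coordJ
    (hE : ∀ a, poisson V t f (poisson V t h (coordJ a)) =
      poisson V t (poisson V t f h) (coordJ a) + poisson V t h (poisson V t f (coordJ a))) :
    poisson V t f (poisson V t h k) =
      poisson V t (poisson V t f h) k + poisson V t h (poisson V t f k) := by
  have hD : ⁅poissonDer V t f, poissonDer V t h⁆ = poissonDer V t (poisson V t f h) :=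
    derivation_ext_coordJ fun a => by
      rw [Derivation.commutator_apply, sub_eq_iff_eq_add]
      simp only [poissonDer_apply, hE]
  have hk := DFunLike.congr_fun hD k
  rw [Derivation.commutator_apply, sub_eq_iff_eq_add] at hk
  simpa only [poissonDer_apply] using hk

theorem poisson_poisson (hV : (LieModule.traceForm ℝ g V).Nondegenerate) :
    poisson V t f (poisson V t h k) =
      poisson V t (poisson V t f h) k + poisson V t h (poisson V t f k) := by
  refine poisson_poisson_of_coordJ fun a => poisson_poisson_rotate <|
    poisson_poisson_of_coordJ fun b => poisson_poisson_rotate <|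
      poisson_poisson_of_coordJ fun c => ?_
  simp only [← linJ_lowered t hV, poisson_linJ t hV, ← map_add]
  rw [leibniz_lie]

end Jacobi

end LiePoisson

section Invariants

variable {ι g : Type*} [Fintype ι] [DecidableEq ι] [LieRing g] [LieAlgebra ℝ g]
  {V : Type*} [AddCommGroup V] [Module ℝ V] [LieRingModule g V] [LieModule ℝ g V]
  (t : Module.Basis ι ℝ g) {d : ι → ℤ} {h : g}

omit [DecidableEq ι] in
theorem isInvariant_iff {𝒢 : ThreeGrading g} (hh : IsGradingElement h)
    (h𝒢 : 𝒢.space 1 = gradePiece ℝ h 1) {P : MvPolynomial ι ℝ} :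
    IsInvariant t 𝒢 P ↔ ∀ u ∈ gradePiece ℝ h 1, adDer t u P = 0 := by
  rw [IsInvariant, h𝒢]
  refine ⟨fun hP u hu => (adDer_eq_zero_iff hh hu).mpr fun r x =>
    hP _ (Submodule.smul_mem _ r hu) x, fun hP u hu x => ?_⟩
  simpa only [one_smul] using (adDer_eq_zero_iff hh hu).mp (hP u hu) 1 x

variable (V) (d h) in
/-- The enlarged `W`-algebra in infinitesimal form: the functions `P(J_a)/Q(J_α)` which Poisson
commute with the linear functions `linJ V t u`, where `u` has degree one for `ad h`. -/
def poissonInvariants : Subalgebra ℝ (RatFun ι) where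
  carrier := {f | f ∈ polyOverNeg d ∧ ∀ u ∈ gradePiece ℝ h 1, poissonDer V t (linJ V t u) f = 0}
  add_mem' hf hf' := ⟨by
    rw [mem_polyOverNeg]
    exact add_mem (mem_polyOverNeg.mp hf.1) (mem_polyOverNeg.mp hf'.1),
    fun u hu => by rw [map_add, hf.2 u hu, hf'.2 u hu, add_zero]⟩
  mul_mem' hf hf' := ⟨by
    rw [mem_polyOverNeg]
    exact mul_mem (mem_polyOverNeg.mp hf.1) (mem_polyOverNeg.mp hf'.1),
    fun u hu => by
      rw [Derivation.leibniz, hf.2 u hu, hf'.2 u hu, smul_zero, smul_zero, add_zero]⟩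
  algebraMap_mem' r := ⟨by
    rw [mem_polyOverNeg]
    exact Subalgebra.algebraMap_mem _ r, fun u _ => Derivation.map_algebraMap _ r⟩

variable (hV : (LieModule.traceForm ℝ g V).Nondegenerate)

include hV

theorem poissonDer_linJ_ofPoly (u : g) (P : MvPolynomial ι ℝ) :
    poissonDer V t (linJ V t u) (ofPoly P) = ofPoly (adDer t u P) := by
  have hD : (poissonDer V t (linJ V t u)).compAlgebraMap (MvPolynomial ι ℝ) =
      (Algebra.linearMap (MvPolynomial ι ℝ) (RatFun ι)).compDer (adDer t u) := by
    refine MvPolynomial.derivation_ext fun a => ?_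
    change poissonDer V t (linJ V t u) (coordJ a) = ofPoly (adDer t u (MvPolynomial.X a))
    rw [poissonDer_apply, poisson_linJ_coordJ t hV, adDer_X, ofPoly_eq_aeval]
    simp
  exact DFunLike.congr_fun hD P

theorem lowered_neg_mem_gradePiece (ht : IsGradedBasis t d h) (α : Neg d) :
    lowered V t α.1 ∈ gradePiece ℝ h 1 := by
  simpa only [α.2, neg_neg] using lowered_mem_gradePiece t hV ht α.1

theorem poissonDer_linJ_of_mem_negField (ht : IsGradedBasis t d h) {u : g}
    (hu : u ∈ gradePiece ℝ h 1) {f : RatFun ι} (hf : f ∈ negField d) :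
    poissonDer V t (linJ V t u) f = 0 := by
  refine derivation_eq_zero_of_mem_negField (fun α => ?_) hf
  rw [poissonDer_apply, ← linJ_lowered t hV, poisson_linJ t hV, ht.isGradingElement.lie_eq_zero
    one_ne_zero hu (lowered_neg_mem_gradePiece t hV ht α), map_zero]

theorem poissonDer_linJ_div_eq_zero_iff (ht : IsGradedBasis t d h) {u : g}
    (hu : u ∈ gradePiece ℝ h 1) (P : MvPolynomial ι ℝ) {Q : MvPolynomial (Neg d) ℝ} (hQ : Q ≠ 0) :
    poissonDer V t (linJ V t u) (ofPoly P / ofNegPoly d Q) = 0 ↔ adDer t u P = 0 := by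
  rw [Derivation.leibniz_div_const _ _ _
      (poissonDer_linJ_of_mem_negField t hV ht hu (ofNegPoly_mem_negField Q)),
    poissonDer_linJ_ofPoly t hV, smul_eq_zero, or_iff_right (inv_ne_zero (ofNegPoly_ne_zero hQ)),
    ofPoly, FaithfulSMul.algebraMap_eq_zero_iff]

theorem negField_le_poissonInvariants (ht : IsGradedBasis t d h) :
    (negField d).toSubalgebra ≤ poissonInvariants V t d h := fun _ hf =>
  ⟨mem_polyOverNeg.mpr (negField_le_wSubalgebra hf),
    fun _ hu => poissonDer_linJ_of_mem_negField t hV ht hu hf⟩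

variable {t}

theorem mem_poissonInvariants_iff (ht : IsGradedBasis t d h) {f : RatFun ι} :
    f ∈ poissonInvariants V t d h ↔ ∃ (P : MvPolynomial ι ℝ) (Q : MvPolynomial (Neg d) ℝ),
      (∀ u ∈ gradePiece ℝ h 1, adDer t u P = 0) ∧ Q ≠ 0 ∧ f = ofPoly P / ofNegPoly d Q := by
  constructor
  · rintro ⟨⟨P, Q, hQ, rfl⟩, hf⟩
    exact ⟨P, Q, fun u hu => (poissonDer_linJ_div_eq_zero_iff t hV ht hu P hQ).mp (hf u hu), hQ,
      rfl⟩
  · rintro ⟨P, Q, hP, hQ, rfl⟩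
    exact ⟨⟨P, Q, hQ, rfl⟩,
      fun u hu => (poissonDer_linJ_div_eq_zero_iff t hV ht hu P hQ).mpr (hP u hu)⟩

theorem poisson_mem_poissonInvariants {f f' : RatFun ι} (hf : f ∈ poissonInvariants V t d h)
    (hf' : f' ∈ poissonInvariants V t d h) : poisson V t f f' ∈ poissonInvariants V t d h := by
  refine ⟨poisson_mem_polyOverNeg t hf.1 hf'.1, fun u hu => ?_⟩
  have hu0 := hf.2 u hu
  have hu0' := hf'.2 u hu
  rw [poissonDer_apply] at hu0 hu0' ⊢
  rw [poisson_poisson hV, hu0, hu0', ← poissonDer_apply t f, map_zero, poisson_skew,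
    ← poissonDer_apply, map_zero, neg_zero, zero_add]

theorem poisson_coordJ_of_mem_poissonInvariants (ht : IsGradedBasis t d h) (α : Neg d)
    {f : RatFun ι} (hf : f ∈ poissonInvariants V t d h) : poisson V t (coordJ α.1) f = 0 := by
  rw [← poissonDer_apply, ← linJ_lowered t hV]
  exact hf.2 _ (lowered_neg_mem_gradePiece t hV ht α)

end Invariants

section LowestWeightPart

variable {ι g : Type*} [Fintype ι] [LieRing g] [LieAlgebra ℝ g]
  {t : Module.Basis ι ℝ g} {d : ι → ℤ} {h : g}

theorem hasNegCoeffs_iff_mem_coeffs {x : RatFun ι ⊗[ℝ] g} :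
    HasNegCoeffs t d x ↔ x ∈ coeffs t (negField d).toSubalgebra :=
  forall_congr' fun _ => mem_negField.symm

theorem repr_tMinus (a : ι) :
    (t.baseChange (RatFun ι)).repr (tMinus t d) a = if d a = -1 then coordJ a else 0 := by
  classical
  rw [tMinus, map_sum, Finsupp.finsetSum_apply]
  simp only [Module.Basis.baseChange_repr_tmul, t.repr_self, Finsupp.single_apply, ite_smul,
    one_smul, zero_smul]
  split_ifs with ha
  · rw [Finset.sum_eq_single ⟨a, ha⟩] <;> simp +contextual [Subtype.ext_iff]
  · refine Finset.sum_eq_zero fun α _ => if_neg ?_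
    rintro rfl
    exact ha α.2

omit [Fintype ι] in
theorem coordJ_ne_zero (a : ι) : coordJ a ≠ (0 : RatFun ι) := by
  simp [coordJ, ofPoly, MvPolynomial.X_ne_zero]

theorem tMinus_ne_zero {a : ι} (ha : d a = -1) : tMinus t d ≠ 0 := by
  intro hzero
  have hrepr := repr_tMinus (t := t) (d := d) a
  rw [hzero, map_zero, Finsupp.zero_apply, if_pos ha] at hrepr
  exact coordJ_ne_zero a hrepr.symm

theorem tMinus_mem_coeffs : tMinus t d ∈ coeffs t (negField d).toSubalgebra := fun a => by
  rw [repr_tMinus]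
  split_ifs with ha
  · exact coordJ_mem_negField ⟨a, ha⟩
  · exact zero_mem _

theorem jTot_mem_coeffs : jTot t ∈ coeffs t (wSubalgebra d coordJ) := fun a => by
  rw [repr_jTot]
  exact apply_mem_wSubalgebra a

theorem tMinus_mem_gradePiece (ht : IsGradedBasis t d h) :
    tMinus t d ∈ gradePiece (RatFun ι) ((1 : RatFun ι) ⊗ₜ[ℝ] h) (-1) :=
  (ht.baseChange (RatFun ι)).mem_gradePiece_iff.mpr fun a ha => by rw [repr_tMinus, if_neg ha]

theorem jTot_sub_tMinus_mem (ht : IsGradedBasis t d h) :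
    jTot t - tMinus t d ∈ gradePiece (RatFun ι) ((1 : RatFun ι) ⊗ₜ[ℝ] h) 0 ⊔
      gradePiece (RatFun ι) ((1 : RatFun ι) ⊗ₜ[ℝ] h) 1 := by
  rw [← (t.baseChange (RatFun ι)).sum_repr (jTot t - tMinus t d)]
  refine sum_mem fun a _ => ?_
  have hta := (ht.baseChange (RatFun ι)).basis_mem_gradePiece a
  have hd := abs_le.mp (ht.abs_le_one a)
  obtain ha | ha | ha : d a = -1 ∨ d a = 0 ∨ d a = 1 := by omega
  · rw [map_sub, Finsupp.sub_apply, repr_jTot, repr_tMinus, if_pos ha, sub_self, zero_smul]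
    exact zero_mem _
  · exact Submodule.mem_sup_left (Submodule.smul_mem _ _ (ha ▸ hta))
  · exact Submodule.mem_sup_right (Submodule.smul_mem _ _ (ha ▸ hta))

theorem mapCoeff_partialDer_tMinus {a : ι} (ha : d a = -1) :
    mapCoeff (partialDer a : RatFun ι →ₗ[ℝ] RatFun ι) (tMinus t d) =
      (1 : RatFun ι) ⊗ₜ[ℝ] t a := by
  classical
  refine (t.baseChange (RatFun ι)).repr.injective (Finsupp.ext fun b => ?_)
  rw [repr_mapCoeff, repr_tMinus, Module.Basis.baseChange_repr_tmul, t.repr_self,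
    Finsupp.single_apply, Derivation.coeFn_coe, apply_ite (partialDer a), partialDer_coordJ,
    map_zero]
  by_cases hab : a = b
  · subst hab
    simp [ha]
  · simp [hab]

variable [FiniteDimensional ℝ g] [LieAlgebra.IsKilling ℝ g]

theorem eq_zero_of_lie_tMinus_eq_zero (ht : IsGradedBasis t d h) {y : RatFun ι ⊗[ℝ] g}
    (hy : y ∈ gradePiece (RatFun ι) ((1 : RatFun ι) ⊗ₜ[ℝ] h) 1) (hfy : ⁅tMinus t d, y⁆ = 0) :
    y = 0 :=
  eq_zero_of_lie_eq_zero_of_derivation ht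
    (fun a ha => ⟨partialDer a, mapCoeff_partialDer_tMinus ha⟩) hy hfy

variable {𝒢 : ThreeGrading g} (ht : IsGradedBasis t d h)
  (h𝒢 : ∀ i, 𝒢.space i = gradePiece ℝ h i)

include ht h𝒢

theorem exists_isNegSl2 {a : ι} (ha : d a = -1) :
    ∃ t0 tp : RatFun ι ⊗[ℝ] g, IsNegSl2 t d 𝒢 t0 tp := by
  obtain ⟨e, he, heK, htriple⟩ := exists_isSl2Triple_mem_coeffs
    (ht.baseChange (RatFun ι)).isGradingElement (tMinus_mem_gradePiece ht)
    (tMinus_ne_zero (t := t) ha) tMinus_mem_coeffs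
    fun y => eq_zero_of_lie_tMinus_eq_zero ht
  refine ⟨(2 : RatFun ι)⁻¹ • ⁅e, tMinus t d⁆, e, ?_, ?_, ?_, ?_, ?_⟩
  · rwa [smul_inv_smul₀ two_ne_zero]
  · rw [h𝒢, ht.baseChange_gradePiece (RatFun ι)]
    exact Submodule.smul_mem _ _ (by simpa using lie_mem_gradePiece he (tMinus_mem_gradePiece ht))
  · rwa [h𝒢, ht.baseChange_gradePiece (RatFun ι)]
  · rw [hasNegCoeffs_iff_mem_coeffs]
    intro a
    rw [map_smul, Finsupp.smul_apply, smul_eq_mul]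
    exact mul_mem ((negField d).inv_mem (ofNat_mem _ 2)) (LieSubalgebra.lie_mem _ heK
      tMinus_mem_coeffs a)
  · exact hasNegCoeffs_iff_mem_coeffs.mpr heK

theorem IsNegSl2.isSliceTriple {t0 tp : RatFun ι ⊗[ℝ] g} (hN : IsNegSl2 t d 𝒢 t0 tp) :
    IsSliceTriple (RatFun ι) ((1 : RatFun ι) ⊗ₜ[ℝ] h) ((2 : RatFun ι) • t0) tp (tMinus t d) where
  isGradingElement := (ht.baseChange (RatFun ι)).isGradingElement
  triple := hN.triple
  e_mem := ht.baseChange_gradePiece (RatFun ι) 1 ▸ h𝒢 1 ▸ hN.plus_mem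
  f_mem := tMinus_mem_gradePiece ht
  eq_zero_of_lie_eq_zero _ := eq_zero_of_lie_tMinus_eq_zero ht

end LowestWeightPart

section HighestWeightFormOfJTot

variable {ι g : Type*} [Fintype ι] [LieRing g] [LieAlgebra ℝ g]
  {t : Module.Basis ι ℝ g} {d : ι → ℤ} {h : g} {T e : RatFun ι ⊗[ℝ] g}

theorem exists_isHwBasis [FiniteDimensional ℝ g]
    (he : e ∈ coeffs t (negField d).toSubalgebra) :
    ∃ (n : ℕ) (ℓ : Fin n → RatFun ι ⊗[ℝ] g), IsHwBasis t d e ℓ := by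
  obtain ⟨n, ℓ, hli, hspan, hℓ⟩ := exists_basis_ker_ad_mem_coeffs he
  exact ⟨n, ℓ, hli, hspan, fun s => hasNegCoeffs_iff_mem_coeffs.mpr (hℓ s)⟩

variable {S : Type*} {ℓ : S → RatFun ι ⊗[ℝ] g}

omit [Fintype ι] in
theorem IsHwBasis.lie_eq_zero (hℓ : IsHwBasis t d e ℓ) (s : S) : ⁅e, ℓ s⁆ = 0 := by
  have hs : ℓ s ∈ LinearMap.ker (LieAlgebra.ad (RatFun ι) (RatFun ι ⊗[ℝ] g) e) :=
    hℓ.span_eq ▸ Submodule.subset_span ⟨s, rfl⟩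
  rwa [LinearMap.mem_ker, LieAlgebra.ad_apply] at hs

theorem IsHwBasis.mem_coeffs (hℓ : IsHwBasis t d e ℓ) (s : S) :
    ℓ s ∈ EnlargedW.coeffs t (negField d).toSubalgebra :=
  hasNegCoeffs_iff_mem_coeffs.mp (hℓ.coeffs s)

variable [Fintype S] {𝒢 : ThreeGrading g} (ht : IsGradedBasis t d h)
  (h𝒢 : 𝒢.space 1 = gradePiece ℝ h 1)

include ht h𝒢

theorem isHwForm_iff {c : RatFun ι ⊗[ℝ] g} {W : S → RatFun ι} :
    IsHwForm t d 𝒢 ℓ c W ↔ c ∈ gradePiece (RatFun ι) ((1 : RatFun ι) ⊗ₜ[ℝ] h) 1 ∧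
      conjExp (RatFun ι) c (jTot t) = tMinus t d + ∑ s, W s • ℓ s := by
  rw [IsHwForm, h𝒢, ht.baseChange_gradePiece (RatFun ι)]

variable (hs : IsSliceTriple (RatFun ι) ((1 : RatFun ι) ⊗ₜ[ℝ] h) T e (tMinus t d))
  (hℓ : IsHwBasis t d e ℓ)

include hℓ

include hs in
theorem IsSliceTriple.existsUnique_isHwForm [FiniteDimensional ℝ g] :
    ∃! cW : (RatFun ι ⊗[ℝ] g) × (S → RatFun ι), IsHwForm t d 𝒢 ℓ cW.1 cW.2 := by
  simp only [isHwForm_iff ht h𝒢]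
  exact hs.existsUnique_conjExp_eq hℓ.linearIndependent hℓ.span_eq (jTot_sub_tMinus_mem ht)

namespace IsHwForm

variable {c : RatFun ι ⊗[ℝ] g} {W : S → RatFun ι} (hcW : IsHwForm t d 𝒢 ℓ c W)

include hcW

/-- `P` takes the same value at `J_tot` and at its highest weight form, whose coordinates are
linear in the `W s` over `ℝ(J_α)`. -/
theorem ofPoly_mem_wSubalgebra {P : MvPolynomial ι ℝ}
    (hP : ∀ u ∈ gradePiece ℝ h 1, adDer t u P = 0) : ofPoly P ∈ wSubalgebra d W := by
  obtain ⟨hc, hW⟩ := (isHwForm_iff ht h𝒢).mp hcW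
  have hconj := aeval_conjExp_of_adDer_eq_zero ht hP hc (jTot t)
  simp only [repr_jTot] at hconj
  rw [ofPoly_eq_aeval, ← hconj, hW]
  refine aeval_mem_of_forall_mem (fun a => ?_) P
  rw [map_add, Finsupp.add_apply, map_sum, Finsupp.finsetSum_apply]
  refine add_mem (negField_le_wSubalgebra (tMinus_mem_coeffs a)) (sum_mem fun s _ => ?_)
  rw [map_smul, Finsupp.smul_apply]
  exact mul_mem (apply_mem_wSubalgebra s) (negField_le_wSubalgebra (hℓ.mem_coeffs s a))

variable (he : e ∈ coeffs t (negField d).toSubalgebra)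

include hs he

theorem apply_mem_polyOverNeg (s : S) : W s ∈ polyOverNeg d := by
  obtain ⟨hc, hW⟩ := (isHwForm_iff ht h𝒢).mp hcW
  exact mem_polyOverNeg.mpr <| hs.apply_mem_of_conjExp_eq hc (jTot_sub_tMinus_mem ht) he
    tMinus_mem_coeffs hℓ.linearIndependent hℓ.lie_eq_zero hℓ.mem_coeffs hW
    negField_le_wSubalgebra jTot_mem_coeffs s

variable [DecidableEq ι] {V : Type*} [AddCommGroup V] [Module ℝ V] [LieRingModule g V]
  [LieModule ℝ g V] (hV : (LieModule.traceForm ℝ g V).Nondegenerate)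

include hV

theorem poissonDer_linJ_apply (s : S) {u : g} (hu : u ∈ gradePiece ℝ h 1) :
    poissonDer V t (linJ V t u) (W s) = 0 := by
  obtain ⟨hc, hW⟩ := (isHwForm_iff ht h𝒢).mp hcW
  have hv : (1 : RatFun ι) ⊗ₜ[ℝ] u ∈ gradePiece (RatFun ι) ((1 : RatFun ι) ⊗ₜ[ℝ] h) 1 :=
    ht.baseChange_gradePiece (RatFun ι) 1 ▸ Submodule.tmul_mem_baseChange_of_mem _ hu
  exact hs.derivation_apply_eq_zero_of_conjExp_eq hc (jTot_sub_tMinus_mem ht) he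
    tMinus_mem_coeffs hℓ.linearIndependent hℓ.lie_eq_zero hℓ.mem_coeffs hW
    (fun z hz => poissonDer_linJ_of_mem_negField t hV ht hu hz) hv
    (mapCoeff_poissonDer_linJ_jTot t hV u) s

theorem wSubalgebra_eq_poissonInvariants : wSubalgebra d W = poissonInvariants V t d h := by
  refine le_antisymm (wSubalgebra_le (fun s => ?_) (negField_le_poissonInvariants t hV ht)) ?_
  · exact ⟨hcW.apply_mem_polyOverNeg ht h𝒢 hs hℓ he s,
      fun u hu => hcW.poissonDer_linJ_apply ht h𝒢 hs hℓ he hV s hu⟩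
  · intro f hf
    obtain ⟨P, Q, hP, -, rfl⟩ := (mem_poissonInvariants_iff hV ht).mp hf
    rw [div_eq_mul_inv]
    exact mul_mem (hcW.ofPoly_mem_wSubalgebra ht h𝒢 hℓ hP)
      (negField_le_wSubalgebra <| (negField d).inv_mem <| ofNegPoly_mem_negField Q)

end IsHwForm

end HighestWeightFormOfJTot

end EnlargedW

end

open EnlargedW TensorProduct in
theorem proposition1_general {g : Type*} [LieRing g] [LieAlgebra ℝ g] [FiniteDimensional ℝ g]
    [LieAlgebra.IsKilling ℝ g]
    {V : Type*} [AddCommGroup V] [Module ℝ V] [LieRingModule g V] [LieModule ℝ g V]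
    (hV : (LieModule.traceForm ℝ g V).Nondegenerate)
    (𝒢 : ThreeGrading g) (h𝒢 : 𝒢.space (-1) ≠ ⊥)
    {ι : Type*} [Fintype ι] [DecidableEq ι] (t : Module.Basis ι ℝ g)
    (d : ι → ℤ) (ht : ∀ a, t a ∈ 𝒢.space (d a)) :
    (∃ t0 tp : RatFun ι ⊗[ℝ] g, IsNegSl2 t d 𝒢 t0 tp) ∧
    ∀ t0 tp : RatFun ι ⊗[ℝ] g, IsNegSl2 t d 𝒢 t0 tp →
      (∃ (n : ℕ) (ℓ : Fin n → RatFun ι ⊗[ℝ] g), IsHwBasis t d tp ℓ) ∧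
      ∀ {S : Type*} [Fintype S] (ℓ : S → RatFun ι ⊗[ℝ] g), IsHwBasis t d tp ℓ →
        (∃! cW : (RatFun ι ⊗[ℝ] g) × (S → RatFun ι), IsHwForm t d 𝒢 ℓ cW.1 cW.2) ∧
        ∀ (c : RatFun ι ⊗[ℝ] g) (W : S → RatFun ι), IsHwForm t d 𝒢 ℓ c W →
          (∀ s, W s ∈ polyOverNeg d) ∧
          (∀ f ∈ wAlgebra d W, ∀ h ∈ wAlgebra d W, poisson V t f h ∈ wAlgebra d W) ∧
          (wAlgebra d W = {f | ∃ (P : MvPolynomial ι ℝ) (Q : MvPolynomial (Neg d) ℝ),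
            IsInvariant t 𝒢 P ∧ Q ≠ 0 ∧ f = ofPoly P / ofNegPoly d Q}) ∧
          (∀ α : Neg d, coordJ α.1 ∈ wAlgebra d W ∧
            ∀ f ∈ wAlgebra d W, poisson V t (coordJ α.1) f = 0) := by
  obtain ⟨h, hh⟩ := 𝒢.exists_lie_eq_smul
  have hgr : ∀ i, 𝒢.space i = gradePiece ℝ h i := ThreeGrading.space_eq_gradePiece hh ht
  have hth : IsGradedBasis t d h := ThreeGrading.isGradedBasis hh ht
  obtain ⟨a, ha⟩ := hth.exists_eq_of_gradePiece_ne_bot (hgr (-1) ▸ h𝒢)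
  refine ⟨exists_isNegSl2 hth hgr ha, fun t0 tp hN => ?_⟩
  have hs := hN.isSliceTriple hth hgr
  have he := hasNegCoeffs_iff_mem_coeffs.mp hN.plus_coeffs
  refine ⟨exists_isHwBasis he, fun {S} _ ℓ hℓ =>
    ⟨hs.existsUnique_isHwForm hth (hgr 1) hℓ, fun c W hcW => ?_⟩⟩
  have hW : wAlgebra d W = poissonInvariants V t d h := congrArg SetLike.coe <|
    hcW.wSubalgebra_eq_poissonInvariants hth (hgr 1) hs hℓ he hV
  refine ⟨hcW.apply_mem_polyOverNeg hth (hgr 1) hs hℓ he, ?_, ?_, fun α => ⟨?_, ?_⟩⟩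
  · rw [hW]
    exact fun f hf f' hf' => poisson_mem_poissonInvariants hV hf hf'
  · rw [hW]
    ext f
    simp only [isInvariant_iff t hth.isGradingElement (hgr 1)]
    exact mem_poissonInvariants_iff hV hth
  · exact negField_le_wSubalgebra (coordJ_mem_negField α)
  · rw [hW]
    exact fun f hf => poisson_coordJ_of_mem_poissonInvariants hV hth α hf

open EnlargedW TensorProduct in
theorem proposition1 {g : Type*} [LieRing g] [LieAlgebra ℝ g] [FiniteDimensional ℝ g]
    [LieAlgebra.IsSimple ℝ g]
    {V : Type*} [AddCommGroup V] [Module ℝ V] [FiniteDimensional ℝ V] [LieRingModule g V]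
    [LieModule ℝ g V] (hV : (LieModule.traceForm ℝ g V).Nondegenerate)
    (𝒢 : ThreeGrading g) (h𝒢 : 𝒢.space (-1) ≠ ⊥)
    {ι : Type*} [Fintype ι] [DecidableEq ι] (t : Module.Basis ι ℝ g)
    (d : ι → ℤ) (ht : ∀ a, t a ∈ 𝒢.space (d a)) :
    (∃ t0 tp : RatFun ι ⊗[ℝ] g, IsNegSl2 t d 𝒢 t0 tp) ∧
    ∀ t0 tp : RatFun ι ⊗[ℝ] g, IsNegSl2 t d 𝒢 t0 tp →
      (∃ (n : ℕ) (ℓ : Fin n → RatFun ι ⊗[ℝ] g), IsHwBasis t d tp ℓ) ∧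
      ∀ {S : Type*} [Fintype S] (ℓ : S → RatFun ι ⊗[ℝ] g), IsHwBasis t d tp ℓ →
        (∃! cW : (RatFun ι ⊗[ℝ] g) × (S → RatFun ι), IsHwForm t d 𝒢 ℓ cW.1 cW.2) ∧
        ∀ (c : RatFun ι ⊗[ℝ] g) (W : S → RatFun ι), IsHwForm t d 𝒢 ℓ c W →
          -- the generators are quotients `P(J_a)/Q(J_α)`
          (∀ s, W s ∈ polyOverNeg d) ∧
          -- the Poisson bracket closes on the functions `P(W_s, J_α)/Q(J_α)`
          (∀ f ∈ wAlgebra d W, ∀ h ∈ wAlgebra d W, poisson V t f h ∈ wAlgebra d W) ∧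
          -- these functions are all the `G₊`-invariants
          (wAlgebra d W = {f | ∃ (P : MvPolynomial ι ℝ) (Q : MvPolynomial (Neg d) ℝ),
            IsInvariant t 𝒢 P ∧ Q ≠ 0 ∧ f = ofPoly P / ofNegPoly d Q}) ∧
          -- the `J_α` belong to the algebra and are central in it
          (∀ α : Neg d, coordJ α.1 ∈ wAlgebra d W ∧
            ∀ f ∈ wAlgebra d W, poisson V t (coordJ α.1) f = 0) :=
  proposition1_general hV 𝒢 h𝒢 t d ht
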